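/- Let $d,k\ge 2$ be integers, and let $\mathcal T=\mathcal T_{d,k}$ be the rooted tree whose root has $k$ children and all of whose other vertices have $d$ children. An almost automorphism of $\mathcal T$ is a triple $(A,B,\varphi)$, where $A,B$ are finite subtrees of $\mathcal T$ containing the root and $\varphi\colon\mathcal T\setminus A\to\mathcal T\setminus B$ is an isomorphism of rooted forests. It induces a homeomorphism of the space of ends $\partial\mathcal T$, and two almost automorphisms induce the same homeomorphism if and only if they agree outside some finite subtree. The Neretin group $\mathcal N_{d,k}$ is the group of all homeomorphisms of $\partial\mathcal T$ induced by almost automorphisms, equipped with the unique group topology for which the inclusion of the profinite group $\mathrm{Aut}(\mathcal T)$ of automorphisms of the rooted tree is continuous and open. For a locally compact group $G$, a compact $G$-space is a non-empty compact Hausdorff space with a continuous $G$-action. A closed subgroup $H\le G$ is relatively amenable in $G$ if it fixes a (regular Borel) probability measure on every compact $G$-space. A topological group is amenable if it fixes a (regular Borel) probability measure on each of its own compact spaces. A closed subgroup $H\le G$ is confined if the closure of its conjugacy class in the Chabauty space of closed subgroups of $G$ does not contain the trivial subgroup. A subgroup $H\le G$ is cocompact if the coset space $G/H$ is compact. For all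 integers $d,k\ge 2$, the Neretin group $\mathcal N_{d,k}$ has no confined relatively amenable closed subgroup. Moreover, $\mathcal N_{d,k}$ has no cocompact amenable subgroup (closed or not, where the subgroup carries the subspace topology). -/

import Mathlib

open Topology

universe u

/-! ### Relative amenability, amenability, the Chabauty space, confined subgroups -/

/-- A probability measure on a compact Hausdorff space is understood, as usual, to be a regular
Borel measure of total mass one.  `FixesProbMeasure H X` says that some probability measure
on the `G`-space `X` is fixed by every element of the subgroup `H`. -/
def FixesProbMeasure {G : Type u} [Group G] (H : Subgroup G) (X : Type u)
    [TopologicalSpace X] [MulAction G X] [MeasurableSpace X] : Prop :=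
  ∃ μ : MeasureTheory.Measure X, MeasureTheory.IsProbabilityMeasure μ ∧ μ.Regular ∧
    ∀ h ∈ H, μ.map (fun x => h • x) = μ

/-- A subgroup `H` of `G` is relatively amenable in `G` if it fixes a probability measure on every
(non-empty) compact `G`-space.  It is enough to let `X` range over the universe of `G`: every
compact `G`-space contains the closure of an orbit, and such a closure has cardinality
at most `2 ^ 2 ^ |G|`. -/
def IsRelativelyAmenable {G : Type u} [Group G] [TopologicalSpace G] (H : Subgroup G) : Prop :=
  ∀ (X : Type u) [TopologicalSpace X] [CompactSpace X] [T2Space X] [Nonempty X]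
    [MeasurableSpace X] [BorelSpace X] [MulAction G X] [ContinuousSMul G X],
    FixesProbMeasure H X

/-- A topological group is amenable if it fixes a probability measure on each of its (non-empty)
compact spaces. -/
def IsAmenable (G : Type u) [Group G] [TopologicalSpace G] : Prop :=
  IsRelativelyAmenable (⊤ : Subgroup G)

/-- The Chabauty topology on the set of closed subgroups: it is generated by the sets
`{H | H ∩ K = ∅}` for `K` compact and `{H | H ∩ U ≠ ∅}` for `U` open. -/
instance chabautyTopology (G : Type u) [Group G] [TopologicalSpace G] :
    TopologicalSpace (ClosedSubgroup G) :=
  TopologicalSpace.generateFrom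
    ({S | ∃ K : Set G, IsCompact K ∧ S = {H : ClosedSubgroup G | (H : Set G) ∩ K = ∅}} ∪
     {S | ∃ U : Set G, IsOpen U ∧ S = {H : ClosedSubgroup G | ((H : Set G) ∩ U).Nonempty}})

/-- The conjugacy class of a closed subgroup, as a subset of the Chabauty space. -/
def conjClass {G : Type u} [Group G] [TopologicalSpace G] (H : ClosedSubgroup G) :
    Set (ClosedSubgroup G) :=
  {K | ∃ g : G, (K : Subgroup G) = (H : Subgroup G).map (MulAut.conj g).toMonoidHom}

/-- `H` is confined if the closure of its conjugacy class in the Chabauty space does not contain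
the trivial subgroup. -/
def IsConfined {G : Type u} [Group G] [TopologicalSpace G] (H : ClosedSubgroup G) : Prop :=
  ∀ K ∈ closure (conjClass H), (K : Subgroup G) ≠ ⊥

/-- `H` is cocompact in `G` if the coset space `G ⧸ H` is compact. -/
def IsCocompact {G : Type u} [Group G] [TopologicalSpace G] (H : Subgroup G) : Prop :=
  CompactSpace (G ⧸ H)

/-! ### The quasi-regular rooted tree and its space of ends -/

/-- Vertices of the rooted tree whose root has `k` children and whose other vertices all have
`d` children.  The children of `root` are the `node i []`, and the children of `node i w` are the
`node i (j :: w)`. -/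
inductive Vertex (d k : ℕ) : Type
  | root : Vertex d k
  | node : Fin k → List (Fin d) → Vertex d k

namespace Vertex

variable {d k : ℕ}

/-- The neighbour of a vertex on the path to the root (the root is sent to itself). -/
def parent : Vertex d k → Vertex d k
  | root => root
  | node _ [] => root
  | node i (_ :: w) => node i w

/-- The distance to the root. -/
def level : Vertex d k → ℕ
  | root => 0
  | node _ w => w.length + 1

/-- Vertices carry the discrete topology. -/
instance : TopologicalSpace (Vertex d k) := ⊥

instance : DiscreteTopology (Vertex d k) := ⟨rfl⟩

theorem level_parent {v : Vertex d k} (h : v ≠ root) : v.level = v.parent.level + 1 := by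
  rcases v with _ | ⟨i, _ | ⟨j, w⟩⟩
  · exact absurd rfl h
  · rfl
  · rfl

theorem finite_setOf_parent_mem {A : Set (Vertex d k)} (hA : A.Finite) :
    {v : Vertex d k | v.parent ∈ A}.Finite := by
  let child : Vertex d k × Fin d → Vertex d k := fun p => match p.1 with
    | root => root
    | node i w => node i (p.2 :: w)
  have h : {v : Vertex d k | v.parent ∈ A} ⊆
      ({root} ∪ Set.range (fun i : Fin k => node i [])) ∪ child '' (A ×ˢ Set.univ) := by
    rintro (_ | ⟨i, _ | ⟨j, w⟩⟩) hv
    · exact Or.inl (Or.inl rfl)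
    · exact Or.inl (Or.inr ⟨i, rfl⟩)
    · exact Or.inr ⟨(node i w, j), ⟨hv, trivial⟩, rfl⟩
  refine Set.Finite.subset (Set.Finite.union ?_ ((hA.prod Set.finite_univ).image child)) h
  exact (Set.finite_singleton _).union (Set.finite_range _)

end Vertex

/-- The space of ends of the tree.  An end is represented by the unique geodesic ray from the root
which converges to it; the topology is that of pointwise convergence of rays. -/
def Ends (d k : ℕ) : Type :=
  {x : ℕ → Vertex d k // x 0 = .root ∧ ∀ n, x (n + 1) ≠ .root ∧ (x (n + 1)).parent = x n}

namespace Ends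

variable {d k : ℕ}

instance : TopologicalSpace (Ends d k) := inferInstanceAs (TopologicalSpace (Subtype _))

/-- The `n`-th vertex of the ray from the root to the end `ξ`. -/
def ray (ξ : Ends d k) (n : ℕ) : Vertex d k := ξ.1 n

/-- The set `∂T_v` of the ends which are separated from the root by the vertex `v`, that is, those
ends whose ray from the root passes through `v`. -/
def cyl (v : Vertex d k) : Set (Ends d k) := {ξ | ∃ n, ξ.ray n = v}

theorem ray_zero (ξ : Ends d k) : ξ.ray 0 = .root := ξ.2.1

theorem parent_ray (ξ : Ends d k) (n : ℕ) : (ξ.ray (n + 1)).parent = ξ.ray n := (ξ.2.2 n).2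

theorem level_ray (ξ : Ends d k) (n : ℕ) : (ξ.ray n).level = n := by
  induction n with
  | zero => rw [ray_zero]; rfl
  | succ n ih => rw [Vertex.level_parent (v := ξ.ray (n + 1)) (ξ.2.2 n).1, parent_ray, ih]

theorem mem_cyl_parent {ξ : Ends d k} {v : Vertex d k} (h : ξ ∈ cyl v) : ξ ∈ cyl v.parent := by
  obtain ⟨n, rfl⟩ := h
  cases n with
  | zero => exact ⟨0, by rw [ray_zero]; rfl⟩
  | succ n => exact ⟨n, (parent_ray ξ n).symm⟩

theorem exists_ray_notMem (ξ : Ends d k) {A : Set (Vertex d k)} (hA : A.Finite) (n : ℕ) :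
    ∃ m, ξ.ray (n + m) ∉ A := by
  by_contra! h
  have hinj : Function.Injective fun m => ξ.ray (n + m) := fun a b hab => by
    have := congrArg Vertex.level hab
    simp only [level_ray] at this
    omega
  exact Set.infinite_of_injective_forall_mem hinj h hA

end Ends

/-! ### Almost automorphisms and the Neretin group -/

/-- `A` is (the vertex set of) a finite subtree containing the root. -/
structure IsFiniteSubtree {d k : ℕ} (A : Set (Vertex d k)) : Prop where
  finite : A.Finite
  root_mem : .root ∈ A
  parent_mem : ∀ v ∈ A, v.parent ∈ A

/-- `(A, B, φ)` is an almost automorphism of the tree `T`: `A` and `B` are finite subtrees that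
contain the root, and `φ` is an isomorphism of (rooted) forests `T \ A → T \ B`, i.e. a bijection
of the vertex sets which preserves the relation of being a child.  (As `φ` matches the components
of `T \ A` with those of `T \ B`, the two subtrees automatically have boundaries of
the same size.) -/
structure IsAlmostAutomorphism {d k : ℕ} (A B : Set (Vertex d k))
    (φ : PartialEquiv (Vertex d k) (Vertex d k)) : Prop where
  left : IsFiniteSubtree A
  right : IsFiniteSubtree B
  source_eq : φ.source = Aᶜ
  target_eq : φ.target = Bᶜ
  parent_iff : ∀ v ∉ A, ∀ w ∉ A, w.parent = v ↔ (φ w).parent = φ v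

/-- The homeomorphism `g` of the space of ends is induced by the map `φ` defined on the set `S` of
vertices: `g` maps `∂T_v` onto `∂T_{φ v}` for every `v ∈ S`. -/
def Induces {d k : ℕ} (S : Set (Vertex d k)) (φ : Vertex d k → Vertex d k)
    (g : Ends d k ≃ₜ Ends d k) : Prop :=
  ∀ v ∈ S, ∀ ξ : Ends d k, ξ ∈ Ends.cyl v ↔ g ξ ∈ Ends.cyl (φ v)

namespace IsAlmostAutomorphism

variable {d k : ℕ} {A B A' B' : Set (Vertex d k)} {φ φ' : PartialEquiv (Vertex d k) (Vertex d k)}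

theorem map_notMem (h : IsAlmostAutomorphism A B φ) {v : Vertex d k} (hv : v ∉ A) : φ v ∉ B := by
  have := φ.map_source (x := v) (by rw [h.source_eq]; exact hv)
  rwa [h.target_eq] at this

theorem left_inv (h : IsAlmostAutomorphism A B φ) {v : Vertex d k} (hv : v ∉ A) :
    φ.symm (φ v) = v := φ.left_inv (by rw [h.source_eq]; exact hv)

theorem symm (h : IsAlmostAutomorphism A B φ) : IsAlmostAutomorphism B A φ.symm where
  left := h.right
  right := h.left
  source_eq := h.target_eq
  target_eq := h.source_eq
  parent_iff := by
    have hm : ∀ v ∉ B, φ.symm v ∉ A := fun v hv => by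
      have := φ.map_target (x := v) (by rw [h.target_eq]; exact hv)
      rwa [h.source_eq] at this
    have hi : ∀ v ∉ B, φ (φ.symm v) = v := fun v hv =>
      φ.right_inv (by rw [h.target_eq]; exact hv)
    intro v hv w hw
    rw [h.parent_iff _ (hm v hv) _ (hm w hw), hi v hv, hi w hw]

theorem right_inv (h : IsAlmostAutomorphism A B φ) {v : Vertex d k} (hv : v ∉ B) :
    φ (φ.symm v) = v := h.symm.left_inv hv

theorem symm_notMem (h : IsAlmostAutomorphism A B φ) {v : Vertex d k} (hv : v ∉ B) :
    φ.symm v ∉ A := h.symm.map_notMem hv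

theorem refl : IsAlmostAutomorphism ({.root} : Set (Vertex d k)) {.root}
    ((PartialEquiv.refl _).restr {.root}ᶜ) := by
  have h : IsFiniteSubtree ({.root} : Set (Vertex d k)) :=
    ⟨Set.finite_singleton _, rfl, by rintro _ rfl; rfl⟩
  exact ⟨h, h, by simp, by simp, by simp⟩

theorem comp_left (h : IsAlmostAutomorphism A B φ) (h' : IsAlmostAutomorphism A' B' φ') :
    IsFiniteSubtree (φ.trans φ').sourceᶜ := by
  have hsrc : ∀ v, v ∈ (φ.trans φ').source ↔ v ∉ A ∧ φ v ∉ A' := fun v => by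
    rw [PartialEquiv.trans_source, h.source_eq, h'.source_eq]; rfl
  refine ⟨?_, ?_, ?_⟩
  · refine (h.left.finite.union (h'.left.finite.image φ.symm)).subset fun v hv => ?_
    rw [Set.mem_compl_iff, hsrc] at hv
    by_cases hA : v ∈ A
    · exact Or.inl hA
    · exact Or.inr ⟨φ v, by tauto, h.left_inv hA⟩
  · rw [Set.mem_compl_iff, hsrc]
    exact fun hh => hh.1 h.left.root_mem
  · intro v hv hp
    rw [Set.mem_compl_iff, hsrc] at hv
    rw [hsrc] at hp
    have hA : v ∉ A := fun hA => hp.1 (h.left.parent_mem v hA)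
    have hA' : φ v ∈ A' := by tauto
    have := (h.parent_iff _ hp.1 _ hA).1 rfl
    exact hp.2 (this ▸ h'.left.parent_mem _ hA')

theorem trans (h : IsAlmostAutomorphism A B φ) (h' : IsAlmostAutomorphism A' B' φ') :
    IsAlmostAutomorphism (φ.trans φ').sourceᶜ (φ.trans φ').targetᶜ (φ.trans φ') where
  left := h.comp_left h'
  right := by simpa using h'.symm.comp_left h.symm
  source_eq := (compl_compl _).symm
  target_eq := (compl_compl _).symm
  parent_iff := by
    have hsrc : ∀ v, v ∈ (φ.trans φ').source ↔ v ∉ A ∧ φ v ∉ A' := fun v => by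
      rw [PartialEquiv.trans_source, h.source_eq, h'.source_eq]; rfl
    intro v hv w hw
    rw [Set.mem_compl_iff, not_not, hsrc] at hv hw
    rw [h.parent_iff _ hv.1 _ hw.1, h'.parent_iff _ hv.2 _ hw.2]
    rfl

end IsAlmostAutomorphism

/-- The Neretin group as a group of homeomorphisms of the space of ends: it consists of the
homeomorphisms that are induced by an almost automorphism of the tree.  Two almost
automorphisms which agree outside some finite subtree induce the same homeomorphism. -/
def neretinSubgroup (d k : ℕ) : Subgroup (Ends d k ≃ₜ Ends d k) where
  carrier := {g | ∃ (A B : Set (Vertex d k)) (φ : PartialEquiv (Vertex d k) (Vertex d k)),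
    IsAlmostAutomorphism A B φ ∧ Induces Aᶜ φ g}
  one_mem' := ⟨_, _, _, .refl, fun _ _ _ => Iff.rfl⟩
  mul_mem' := by
    rintro g' g ⟨A', B', φ', h', i'⟩ ⟨A, B, φ, h, i⟩
    refine ⟨_, _, _, h.trans h', fun v hv ξ => ?_⟩
    rw [compl_compl, PartialEquiv.trans_source, h.source_eq, h'.source_eq] at hv
    rw [i v hv.1, i' _ hv.2]
    rfl
  inv_mem' := by
    rintro g ⟨A, B, φ, h, i⟩
    refine ⟨_, _, _, h.symm, fun v hv ξ => ?_⟩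
    rw [i _ (h.symm_notMem hv), h.right_inv hv]
    exact iff_of_eq (congrArg (· ∈ Ends.cyl v) (g.apply_symm_apply ξ).symm)

/-- The Neretin group `N_{d,k}`. -/
def Neretin (d k : ℕ) : Type := neretinSubgroup d k

namespace Neretin

variable {d k : ℕ}

instance : Group (Neretin d k) := inferInstanceAs (Group (neretinSubgroup d k))

/-- The homeomorphism of the space of ends given by an element of the Neretin group. -/
def toHomeo : Neretin d k →* (Ends d k ≃ₜ Ends d k) := (neretinSubgroup d k).subtype

end Neretin

/-! ### The topology of the Neretin group -/

theorem perm_apply_inv {V : Type u} (σ : Equiv.Perm V) (v : V) : σ (σ⁻¹ v) = v :=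
  σ.apply_symm_apply v

theorem perm_inv_apply {V : Type u} (σ : Equiv.Perm V) (v : V) : σ⁻¹ (σ v) = v :=
  σ.symm_apply_apply v

/-- The automorphism group of the rooted tree.  (A permutation of the vertices that commutes with
`parent` fixes the root, which is the only fixed point of `parent`.) -/
def treeAut (d k : ℕ) : Subgroup (Equiv.Perm (Vertex d k)) where
  carrier := {σ | ∀ v, (σ v).parent = σ v.parent}
  one_mem' := fun _ => rfl
  mul_mem' := fun {σ τ} hσ hτ v => by
    change (σ (τ v)).parent = σ (τ v.parent)
    rw [hσ, hτ]
  inv_mem' := fun {σ} hσ v => by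
    apply σ.injective
    rw [← hσ, perm_apply_inv, perm_apply_inv]

namespace Neretin

variable {d k : ℕ}

/-- The image in the Neretin group of the group of those automorphisms of the rooted tree which
fix every vertex in `F`.  For `F` finite these groups of automorphisms form a basis of
identity neighbourhoods of the profinite group of all automorphisms. -/
def fixator (F : Set (Vertex d k)) : Subgroup (Neretin d k) where
  carrier := {a | ∃ σ ∈ treeAut d k, (∀ v ∈ F, σ v = v) ∧ Induces Set.univ σ a.toHomeo}
  one_mem' := ⟨1, one_mem _, fun _ _ => rfl, fun _ _ _ => Iff.rfl⟩
  mul_mem' := by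
    rintro a b ⟨σ, hσ, hF, i⟩ ⟨τ, hτ, hF', i'⟩
    refine ⟨σ * τ, mul_mem hσ hτ, fun v hv => ?_, fun v _ ξ => ?_⟩
    · change σ (τ v) = v
      rw [hF' v hv, hF v hv]
    · rw [i' v trivial, i _ trivial, map_mul]
      rfl
  inv_mem' := by
    rintro a ⟨σ, hσ, hF, i⟩
    refine ⟨σ⁻¹, inv_mem hσ, fun v hv => ?_, fun v _ ξ => ?_⟩
    · rw [Equiv.Perm.inv_eq_iff_eq, hF v hv]
    · rw [i (σ⁻¹ v) trivial, perm_apply_inv, map_inv]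
      exact iff_of_eq (congrArg (· ∈ Ends.cyl v) (a.toHomeo.apply_symm_apply ξ).symm)

theorem fixator_anti {F F' : Set (Vertex d k)} (h : F ⊆ F') : fixator F' ≤ fixator F := by
  rintro a ⟨σ, hσ, hF, i⟩
  exact ⟨σ, hσ, fun v hv => hF v (h hv), i⟩

/-- If a tree automorphism `σ` is compatible with `g` along arbitrarily deep vertices of each ray,
then it is compatible with `g` everywhere. -/
theorem mem_cyl_of_frequently {σ : Equiv.Perm (Vertex d k)} (hσ : σ ∈ treeAut d k)
    {g : Ends d k ≃ₜ Ends d k} {ξ : Ends d k}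
    (h : ∀ n, ∃ m, g ξ ∈ Ends.cyl (σ (ξ.ray (n + m)))) {v : Vertex d k} (hv : ξ ∈ Ends.cyl v) :
    g ξ ∈ Ends.cyl (σ v) := by
  obtain ⟨n, rfl⟩ := hv
  obtain ⟨m, hm⟩ := h n
  induction m with
  | zero => exact hm
  | succ m ih =>
    apply ih
    have := Ends.mem_cyl_parent hm
    rwa [hσ, ← add_assoc, Ends.parent_ray] at this

open Classical in
/-- Extension by the identity on `B` of the conjugate of `σ` by `φ`. -/
noncomputable def conjFun (B : Set (Vertex d k)) (φ : PartialEquiv (Vertex d k) (Vertex d k))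
    (σ : Equiv.Perm (Vertex d k)) (v : Vertex d k) : Vertex d k :=
  if v ∈ B then v else φ (σ (φ.symm v))

section conj

variable {A B : Set (Vertex d k)} {φ : PartialEquiv (Vertex d k) (Vertex d k)}
  {σ : Equiv.Perm (Vertex d k)}

theorem perm_notMem (hA : ∀ v ∈ A, σ v = v) {v : Vertex d k} (hv : v ∉ A) : σ v ∉ A := fun h =>
  hv (σ.injective (hA _ h) ▸ h)

theorem conjFun_of_notMem {v : Vertex d k} (hv : v ∉ B) :
    conjFun B φ σ v = φ (σ (φ.symm v)) := if_neg hv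

theorem conjFun_of_mem {v : Vertex d k} (hv : v ∈ B) : conjFun B φ σ v = v := if_pos hv

theorem conjFun_leftInverse (h : IsAlmostAutomorphism A B φ) (hA : ∀ v ∈ A, σ v = v) :
    Function.LeftInverse (conjFun B φ σ⁻¹) (conjFun B φ σ) := fun v => by
  by_cases hv : v ∈ B
  · rw [conjFun_of_mem hv, conjFun_of_mem hv]
  · have h1 := perm_notMem hA (h.symm_notMem hv)
    rw [conjFun_of_notMem hv, conjFun_of_notMem (h.map_notMem h1), h.left_inv h1,
      perm_inv_apply, h.right_inv hv]

theorem inv_fix {F : Set (Vertex d k)} (hA : ∀ v ∈ F, σ v = v) : ∀ v ∈ F, σ⁻¹ v = v :=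
  fun v hv => by rw [Equiv.Perm.inv_eq_iff_eq, hA v hv]

theorem parent_conjFun (h : IsAlmostAutomorphism A B φ) (hσ : σ ∈ treeAut d k)
    (hA : ∀ v ∈ A, σ v = v) (hA' : ∀ v ∈ {v : Vertex d k | v.parent ∈ A}, σ v = v)
    (v : Vertex d k) :
    (conjFun B φ σ v).parent = conjFun B φ σ v.parent := by
  by_cases hv : v ∈ B
  · rw [conjFun_of_mem hv, conjFun_of_mem (h.right.parent_mem v hv)]
  have hu := h.symm_notMem hv
  by_cases hp : v.parent ∈ B
  · have h1 : (φ.symm v).parent ∈ A := by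
      by_contra hn
      have := (h.parent_iff _ hn _ hu).1 rfl
      rw [h.right_inv hv] at this
      exact h.map_notMem hn (this ▸ hp)
    rw [conjFun_of_mem hp, conjFun_of_notMem hv, hA' _ h1, h.right_inv hv]
  · have h1 : (φ.symm v).parent = φ.symm v.parent := (h.symm.parent_iff _ hp _ hv).1 rfl
    rw [conjFun_of_notMem hv, conjFun_of_notMem hp]
    refine (h.parent_iff _ ?_ _ ?_).1 ?_
    · exact perm_notMem hA (h.symm_notMem hp)
    · exact perm_notMem hA hu
    · rw [hσ, h1]

theorem mem_cyl_conjFun (h : IsAlmostAutomorphism A B φ) {g a : Neretin d k}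
    (hg : Induces Aᶜ φ g.toHomeo) (ha : Induces Set.univ σ a.toHomeo) (hA : ∀ v ∈ A, σ v = v)
    {v : Vertex d k} (hv : v ∉ B) {ξ : Ends d k} (hξ : ξ ∈ Ends.cyl v) :
    (g * a * g⁻¹).toHomeo ξ ∈ Ends.cyl (conjFun B φ σ v) := by
  have hu := h.symm_notMem hv
  have e : g.toHomeo (g⁻¹.toHomeo ξ) = ξ := by
    rw [map_inv]; exact g.toHomeo.apply_symm_apply ξ
  have h1 : g⁻¹.toHomeo ξ ∈ Ends.cyl (φ.symm v) := by
    rw [hg _ hu, h.right_inv hv, e]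
    exact hξ
  rw [ha _ trivial, hg _ (perm_notMem hA hu)] at h1
  rw [conjFun_of_notMem hv, map_mul, map_mul]
  exact h1

end conj

theorem exists_fixator_conj (g : Neretin d k) {F : Set (Vertex d k)} (hF : F.Finite) :
    ∃ F' : Set (Vertex d k), F'.Finite ∧ ∀ a ∈ fixator F', g * a * g⁻¹ ∈ fixator F := by
  obtain ⟨A, B, φ, h, hg⟩ := g.2
  refine ⟨A ∪ {v | v.parent ∈ A} ∪ φ.symm '' F,
    (h.left.finite.union (Vertex.finite_setOf_parent_mem h.left.finite)).union (hF.image _), ?_⟩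
  rintro a ⟨σ, hσ, hfix, ha⟩
  have hA : ∀ v ∈ A, σ v = v := fun v hv => hfix v (Or.inl (Or.inl hv))
  have hA' : ∀ v ∈ {v : Vertex d k | v.parent ∈ A}, σ v = v :=
    fun v hv => hfix v (Or.inl (Or.inr hv))
  have ha' : Induces Set.univ (σ⁻¹ : Equiv.Perm _) (a⁻¹).toHomeo := fun v _ ξ => by
    rw [ha (σ⁻¹ v) trivial, perm_apply_inv, map_inv]
    exact iff_of_eq (congrArg (· ∈ Ends.cyl v) (a.toHomeo.apply_symm_apply ξ).symm)
  have hinv : Function.RightInverse (conjFun B φ σ⁻¹) (conjFun B φ σ) := by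
    have := conjFun_leftInverse h (inv_fix hA)
    rwa [inv_inv] at this
  let τ : Equiv.Perm (Vertex d k) :=
    ⟨conjFun B φ σ, conjFun B φ σ⁻¹, conjFun_leftInverse h hA, hinv⟩
  have hτ : τ ∈ treeAut d k := parent_conjFun h hσ hA hA'
  have hτF : ∀ v ∈ F, τ v = v := fun v hv => by
    change conjFun B φ σ v = v
    by_cases hB : v ∈ B
    · exact conjFun_of_mem hB
    · rw [conjFun_of_notMem hB, hfix _ (Or.inr ⟨v, hv, rfl⟩), h.right_inv hB]
  have k1 : ∀ (v : Vertex d k) (ξ : Ends d k), ξ ∈ Ends.cyl v →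
      (g * a * g⁻¹).toHomeo ξ ∈ Ends.cyl (τ v) := fun v ξ hξ => by
    refine mem_cyl_of_frequently hτ (fun n => ?_) hξ
    obtain ⟨m, hm⟩ := ξ.exists_ray_notMem h.right.finite n
    exact ⟨m, mem_cyl_conjFun h hg ha hA hm ⟨_, rfl⟩⟩
  have k2 : ∀ (v : Vertex d k) (ξ : Ends d k), ξ ∈ Ends.cyl v →
      (g * a⁻¹ * g⁻¹).toHomeo ξ ∈ Ends.cyl (τ⁻¹ v) := fun v ξ hξ => by
    refine mem_cyl_of_frequently (inv_mem hτ) (fun n => ?_) hξ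
    obtain ⟨m, hm⟩ := ξ.exists_ray_notMem h.right.finite n
    exact ⟨m, mem_cyl_conjFun h hg ha' (inv_fix hA) hm ⟨_, rfl⟩⟩
  refine ⟨τ, hτ, hτF, fun v _ ξ => ⟨k1 v ξ, fun hξ => ?_⟩⟩
  have h2 := k2 _ _ hξ
  have e : (g * a⁻¹ * g⁻¹).toHomeo ((g * a * g⁻¹).toHomeo ξ) = ξ := by
    have : (g * a⁻¹ * g⁻¹).toHomeo * (g * a * g⁻¹).toHomeo = 1 := by
      rw [← map_mul, ← map_one toHomeo]
      congr 1
      group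
    exact DFunLike.congr_fun this ξ
  rwa [e, perm_inv_apply] at h2

/-- The images of the fixators of finite sets of vertices in the automorphism group of the rooted
tree satisfy the axioms for a basis of identity neighbourhoods of a group topology. -/
@[reducible] def filterBasis (d k : ℕ) : GroupFilterBasis (Neretin d k) where
  sets := {U | ∃ F : Set (Vertex d k), F.Finite ∧ U = fixator F}
  nonempty := ⟨_, ∅, Set.finite_empty, rfl⟩
  inter_sets := by
    rintro _ _ ⟨F, hF, rfl⟩ ⟨F', hF', rfl⟩
    exact ⟨_, ⟨F ∪ F', hF.union hF', rfl⟩, Set.subset_inter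
      (fixator_anti Set.subset_union_left) (fixator_anti Set.subset_union_right)⟩
  one' := by
    rintro _ ⟨F, hF, rfl⟩
    exact one_mem _
  mul' := by
    rintro _ ⟨F, hF, rfl⟩
    refine ⟨_, ⟨F, hF, rfl⟩, ?_⟩
    rintro _ ⟨a, ha, b, hb, rfl⟩
    exact mul_mem ha hb
  inv' := by
    rintro _ ⟨F, hF, rfl⟩
    exact ⟨_, ⟨F, hF, rfl⟩, fun a ha => inv_mem ha⟩
  conj' := by
    rintro g _ ⟨F, hF, rfl⟩
    obtain ⟨F', hF', h⟩ := exists_fixator_conj g hF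
    exact ⟨_, ⟨F', hF', rfl⟩, h⟩

/-- The topology of the Neretin group: the group topology for which the inclusion of the profinite
automorphism group of the rooted tree is continuous and open. -/
instance : TopologicalSpace (Neretin d k) := (filterBasis d k).topology

instance : IsTopologicalGroup (Neretin d k) := (filterBasis d k).isTopologicalGroup

end Neretin

/-! Let `H` be relatively amenable. The choice functions on the non-empty clopen sets of ends form a
compact space, and an `H`-invariant probability measure on it evaluates to probability measures `μ
U` on the clopen sets `U` with `μ (h • U) (h • A) = μ U A` for `h ∈ H`
(`exists_invariant_measures`). No such system can tolerate the flexibility of the Neretin group. An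
element supported in a clopen set can squeeze almost the whole set into any non-empty clopen part of
it (`exists_contraction`). Hence, along a finite descending chain of clopen sets, a single element
`f` makes each measure put more than half of its mass on a prescribed part (`exists_concentrating`).

The chain is chosen to detect all elements `g` that move levels by at most `M` below level `N`. If
`f * g * f⁻¹ ∈ H`, invariance forbids `g` to carry a heavy part to a set disjoint from a heavy part
of the image. Running through the vertices of level `N` one by one, this shows that `g` preserves
their cylinders and shifts no levels, so `g` is a tree automorphism fixing the ball of radius `N`.
Thus some conjugate of `H` avoids all elements of bounded complexity outside a given identity
neighbourhood (`exists_conj_avoiding`).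

A compact set is covered by finitely many cosets of the image of the tree automorphism group, so its
complexity is bounded. Chabauty neighbourhoods of the trivial subgroup only test compact sets
missing the identity, so `H` is not confined. If `H` is cocompact, then the group is `T * O * H`
with `T` finite and `O` the image of the tree automorphism group. For `h₀ ≠ 1` in `H`, the
conjugates of `h₀` by `T * O` have bounded complexity and stay away from the identity, yet every
conjugate of `H` contains one of them. This contradicts `exists_conj_avoiding`. -/

open scoped Pointwise

/-! ### Levels and ancestors of vertices -/

namespace Vertex

variable {d k : ℕ}

theorem level_eq_zero_iff {v : Vertex d k} : v.level = 0 ↔ v = root := by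
  rcases v with _ | ⟨i, w⟩ <;> simp [level]

theorem level_parent_eq (v : Vertex d k) : v.parent.level = v.level - 1 := by
  by_cases h : v = root
  · subst h; rfl
  · rw [level_parent h, Nat.add_sub_cancel]

theorem level_iterate_parent (v : Vertex d k) (n : ℕ) :
    (parent^[n] v).level = v.level - n := by
  induction n with
  | zero => rfl
  | succ n ih => rw [Function.iterate_succ_apply', level_parent_eq, ih]; omega

theorem finite_level_eq (n : ℕ) : {v : Vertex d k | v.level = n}.Finite := by
  induction n with
  | zero =>
    refine (Set.finite_singleton root).subset fun v hv => level_eq_zero_iff.1 hv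
  | succ n ih =>
    refine (finite_setOf_parent_mem ih).subset fun v hv => ?_
    have hv' : v.level = n + 1 := hv
    change v.parent.level = n
    rw [level_parent_eq, hv', Nat.add_sub_cancel]

theorem exists_child (hd : 2 ≤ d) (hk : 2 ≤ k) (v : Vertex d k) :
    ∃ u u' : Vertex d k, u ≠ u' ∧ u.parent = v ∧ u'.parent = v ∧ u ≠ root ∧ u' ≠ root := by
  rcases v with _ | ⟨i, w⟩
  · exact ⟨node ⟨0, by omega⟩ [], node ⟨1, by omega⟩ [], by simp, rfl, rfl, by simp, by simp⟩
  · exact ⟨node i (⟨0, by omega⟩ :: w), node i (⟨1, by omega⟩ :: w), by simp, rfl, rfl,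
      by simp, by simp⟩

/-- The ancestor of `v` at level `n` (junk if `n` exceeds the level of `v`). -/
def anc (n : ℕ) (v : Vertex d k) : Vertex d k := parent^[v.level - n] v

theorem level_anc {n : ℕ} {v : Vertex d k} (h : n ≤ v.level) : (anc n v).level = n := by
  rw [anc, level_iterate_parent]; omega

theorem anc_level (v : Vertex d k) : anc v.level v = v := by simp [anc]

theorem parent_anc {n : ℕ} {v : Vertex d k} (h : n + 1 ≤ v.level) :
    (anc (n + 1) v).parent = anc n v := by
  rw [anc, ← Function.iterate_succ_apply' parent, anc]
  congr 2; omega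

theorem anc_parent {n : ℕ} {v : Vertex d k} (h : n + 1 ≤ v.level) :
    anc n v.parent = anc n v := by
  rw [anc, ← Function.iterate_succ_apply parent, anc, level_parent_eq]
  congr 2; omega

end Vertex

/-! ### Cylinders and the topology of the space of ends -/

namespace Ends

variable {d k : ℕ}

theorem ext_ray {ξ η : Ends d k} (h : ∀ n, ξ.ray n = η.ray n) : ξ = η := Subtype.ext (funext h)

theorem mem_cyl_iff {ξ : Ends d k} {v : Vertex d k} : ξ ∈ cyl v ↔ ξ.ray v.level = v := by
  constructor
  · rintro ⟨n, rfl⟩; rw [level_ray]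
  · exact fun h => ⟨_, h⟩

theorem mem_cyl_ray (ξ : Ends d k) (n : ℕ) : ξ ∈ cyl (ξ.ray n) := ⟨n, rfl⟩

theorem mem_cyl_ray_iff {ξ η : Ends d k} {n : ℕ} : η ∈ cyl (ξ.ray n) ↔ η.ray n = ξ.ray n := by
  rw [mem_cyl_iff, level_ray]

theorem ray_eq_of_le {ξ η : Ends d k} {n m : ℕ} (h : ξ.ray m = η.ray m) (hnm : n ≤ m) :
    ξ.ray n = η.ray n := by
  induction m, hnm using Nat.le_induction with
  | base => exact h
  | succ m _ ih => exact ih (by rw [← parent_ray, h, parent_ray])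

theorem cyl_ray_anti (ξ : Ends d k) {n m : ℕ} (h : n ≤ m) : cyl (ξ.ray m) ⊆ cyl (ξ.ray n) :=
  fun _ hη => mem_cyl_ray_iff.2 (ray_eq_of_le (mem_cyl_ray_iff.1 hη) h)

/-- A descending path of vertices converges to an end. -/
theorem exists_of_path (u : ℕ → Vertex d k) (h : ∀ n, u (n + 1) ≠ .root ∧ (u (n + 1)).parent = u n) :
    ∃ ξ : Ends d k, ∀ n, ξ ∈ cyl (u n) := by
  have hl : ∀ n, (u n).level = (u 0).level + n := fun n => by
    induction n with
    | zero => rfl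
    | succ n ih => rw [Vertex.level_parent (h n).1, (h n).2, ih]; omega
  have hy : ∀ n, (Vertex.anc n (u n)).level = n := fun n => Vertex.level_anc (by rw [hl]; omega)
  have ha : ∀ j n i, i ≤ (u n).level → Vertex.anc i (u (n + j)) = Vertex.anc i (u n) := by
    intro j n i hi
    induction j with
    | zero => rfl
    | succ j ih =>
      rw [← ih, ← (h (n + j)).2, Vertex.anc_parent]
      · rfl
      · rw [hl] at hi
        rw [show n + j + 1 = n + (j + 1) by omega, hl]
        omega
  -- The path may start below the root, but `u n` has level at least `n`, so its ancestor at level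
  -- `n` is available as the `n`-th vertex of the ray.
  refine ⟨⟨fun n => Vertex.anc n (u n), Vertex.level_eq_zero_iff.1 (hy 0), fun n => ⟨?_, ?_⟩⟩,
    fun n => ⟨(u n).level, ?_⟩⟩
  · intro h0
    have := Vertex.level_eq_zero_iff.2 h0
    rw [hy] at this
    omega
  · rw [Vertex.parent_anc (by rw [hl]; omega)]
    exact ha 1 n n (by rw [hl]; omega)
  · change Vertex.anc (u n).level (u (u n).level) = u n
    have : (u n).level = n + (u 0).level := by rw [hl]; omega
    conv_lhs => rw [this]
    rw [ha _ _ _ (by omega), ← this, Vertex.anc_level]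

theorem nonempty_cyl (hd : 2 ≤ d) (hk : 2 ≤ k) (v : Vertex d k) : (cyl v).Nonempty := by
  choose c _ _ hc _ hc' _ using Vertex.exists_child hd hk
  obtain ⟨ξ, hξ⟩ := exists_of_path (fun n => c^[n] v) fun n => by
    rw [Function.iterate_succ_apply']
    exact ⟨hc' _, hc _⟩
  exact ⟨ξ, hξ 0⟩

/-- The cylinders along a ray are strictly decreasing. -/
theorem exists_branch (hd : 2 ≤ d) (hk : 2 ≤ k) (ξ : Ends d k) (n : ℕ) :
    ∃ η : Ends d k, η.ray n = ξ.ray n ∧ η.ray (n + 1) ≠ ξ.ray (n + 1) := by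
  obtain ⟨u, u', hne, hu, hu', hr, hr'⟩ := Vertex.exists_child hd hk (ξ.ray n)
  obtain ⟨w, hw, hwr, hwne⟩ : ∃ w : Vertex d k, w.parent = ξ.ray n ∧ w ≠ .root ∧
      w ≠ ξ.ray (n + 1) := by
    by_cases h : u = ξ.ray (n + 1)
    · exact ⟨u', hu', hr', fun h' => hne (h.trans h'.symm)⟩
    · exact ⟨u, hu, hr, h⟩
  obtain ⟨η, hη⟩ := nonempty_cyl hd hk w
  have hl : w.level = n + 1 := by rw [Vertex.level_parent hwr, hw, level_ray]
  have h1 : η.ray (n + 1) = w := by rw [← hl]; exact mem_cyl_iff.1 hη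
  exact ⟨η, by rw [← parent_ray, h1, hw], by rwa [h1]⟩

/-- Since every vertex has at least two children, a cylinder determines the level of its vertex.
This is what makes level shifts visible in the action on sets of ends. -/
theorem le_of_cyl_ray_subset (hd : 2 ≤ d) (hk : 2 ≤ k) {ξ η : Ends d k} {n m : ℕ}
    (h : cyl (ξ.ray n) ⊆ cyl (η.ray m)) : m ≤ n := by
  by_contra! hlt
  obtain ⟨ζ, h1, h2⟩ := exists_branch hd hk ξ n
  have h3 := mem_cyl_ray_iff.1 (h (mem_cyl_ray_iff.2 h1))
  have h4 := mem_cyl_ray_iff.1 (h (mem_cyl_ray ξ n))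
  exact h2 (ray_eq_of_le (h3.trans h4.symm) hlt)

theorem isClopen_ray_preimage (n : ℕ) (S : Set (Vertex d k)) :
    IsClopen {ξ : Ends d k | ξ.ray n ∈ S} :=
  (isClopen_discrete S).preimage ((continuous_apply n).comp continuous_subtype_val)

theorem cyl_eq_preimage (v : Vertex d k) : cyl v = {ξ : Ends d k | ξ.ray v.level ∈ ({v} : Set _)} :=
  Set.ext fun _ => mem_cyl_iff

theorem isClopen_cyl (v : Vertex d k) : IsClopen (cyl v) := by
  rw [cyl_eq_preimage]; exact isClopen_ray_preimage _ _

instance : T2Space (Ends d k) := inferInstanceAs (T2Space (Subtype _))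

instance : CompactSpace (Ends d k) := by
  refine isCompact_iff_compactSpace.1 (?_ : IsCompact {x : ℕ → Vertex d k |
    x 0 = .root ∧ ∀ n, x (n + 1) ≠ .root ∧ (x (n + 1)).parent = x n})
  refine (isCompact_univ_pi fun n => (Vertex.finite_level_eq (d := d) (k := k) n).isCompact).of_isClosed_subset
    ?_ fun x hx n _ => level_ray (⟨x, hx⟩ : Ends d k) n
  have h0 : IsClosed {x : ℕ → Vertex d k | x 0 = .root} :=
    isClosed_eq (continuous_apply _) continuous_const
  have h1 : ∀ n, IsClosed {x : ℕ → Vertex d k | x (n + 1) ≠ .root} := fun n =>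
    (isClosed_discrete {Vertex.root}ᶜ).preimage
      (continuous_apply (A := fun _ : ℕ => Vertex d k) (n + 1))
  have h2 : ∀ n, IsClosed {x : ℕ → Vertex d k | (x (n + 1)).parent = x n} := fun n =>
    isClosed_eq ((continuous_of_discreteTopology (f := Vertex.parent)).comp
      (continuous_apply (A := fun _ : ℕ => Vertex d k) (n + 1))) (continuous_apply _)
  have : {x : ℕ → Vertex d k | x 0 = .root ∧ ∀ n, x (n + 1) ≠ .root ∧ (x (n + 1)).parent = x n} =
      {x | x 0 = .root} ∩ ⋂ n, {x | x (n + 1) ≠ .root} ∩ {x | (x (n + 1)).parent = x n} := by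
    ext x; simp
  rw [this]
  exact h0.inter (isClosed_iInter fun n => (h1 n).inter (h2 n))

/-- Cylinders form a neighbourhood basis. -/
theorem exists_cyl_subset {U : Set (Ends d k)} (hU : IsOpen U) {ξ : Ends d k} (hξ : ξ ∈ U) :
    ∃ n, cyl (ξ.ray n) ⊆ U := by
  obtain ⟨V, hV, rfl⟩ := isOpen_induced_iff.1 hU
  obtain ⟨I, u, hu, hs⟩ := isOpen_pi_iff.1 hV _ hξ
  obtain ⟨n, hn⟩ := I.bddAbove
  refine ⟨n, fun η hη => hs fun i hi => ?_⟩
  have := ray_eq_of_le (mem_cyl_ray_iff.1 hη) (hn hi)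
  change η.ray i ∈ u i
  rw [this]
  exact (hu i hi).2

/-- Membership in a clopen set is decided at a finite level. -/
theorem exists_level_of_isClopen {U : Set (Ends d k)} (hU : IsClopen U) :
    ∃ n, ∀ ξ η : Ends d k, ξ.ray n = η.ray n → ξ ∈ U → η ∈ U := by
  have h : ∀ ξ : Ends d k, ξ ∈ U → ∃ n, cyl (ξ.ray n) ⊆ U := fun ξ hξ => exists_cyl_subset hU.2 hξ
  choose! N hN using h
  obtain ⟨t, ht, hc⟩ := hU.1.isCompact.elim_nhds_subcover (fun ξ => cyl (ξ.ray (N ξ)))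
    fun ξ _ => (isClopen_cyl _).2.mem_nhds (mem_cyl_ray _ _)
  refine ⟨t.sup N, fun ξ η h hξ => ?_⟩
  obtain ⟨ζ, hζ, hm⟩ := Set.mem_iUnion₂.1 (hc hξ)
  refine hN ζ (ht ζ hζ) (mem_cyl_ray_iff.2 ?_)
  rw [← mem_cyl_ray_iff.1 hm]
  exact ray_eq_of_le h.symm (Finset.le_sup hζ)

end Ends

/-! ### The action on ends and identity neighbourhoods -/

namespace Neretin

variable {d k : ℕ}

open Ends

instance : MulAction (Neretin d k) (Ends d k) where
  smul g ξ := g.toHomeo ξ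
  one_smul _ := rfl
  mul_smul _ _ _ := rfl

theorem smul_def (g : Neretin d k) (ξ : Ends d k) : g • ξ = g.toHomeo ξ := rfl

theorem fixator_mem_nhds_one {F : Set (Vertex d k)} (hF : F.Finite) :
    (fixator F : Set (Neretin d k)) ∈ 𝓝 1 :=
  (filterBasis d k).mem_nhds_one ⟨F, hF, rfl⟩

theorem isOpen_fixator {F : Set (Vertex d k)} (hF : F.Finite) :
    IsOpen (fixator F : Set (Neretin d k)) :=
  Subgroup.isOpen_of_mem_nhds _ (fixator_mem_nhds_one hF)

theorem exists_fixator_subset {U : Set (Neretin d k)} (hU : U ∈ 𝓝 1) :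
    ∃ F : Set (Vertex d k), F.Finite ∧ (fixator F : Set (Neretin d k)) ⊆ U := by
  obtain ⟨_, ⟨F, hF, rfl⟩, h⟩ := (filterBasis d k).nhds_one_hasBasis.mem_iff.1 hU
  exact ⟨F, hF, h⟩

theorem smul_mem_cyl_iff {F : Set (Vertex d k)} {a : Neretin d k} (ha : a ∈ fixator F)
    {v : Vertex d k} (hv : v ∈ F) {ξ : Ends d k} : a • ξ ∈ cyl v ↔ ξ ∈ cyl v := by
  obtain ⟨σ, hσ, hF, i⟩ := ha
  have := i v trivial ξ
  rw [hF v hv] at this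
  exact this.symm

theorem eq_one_of_smul {a : Neretin d k} (h : ∀ ξ : Ends d k, a • ξ = ξ) : a = 1 :=
  Subtype.ext (Homeomorph.ext h)

theorem exists_notMem_fixator {a : Neretin d k} (h : a ≠ 1) :
    ∃ F : Set (Vertex d k), F.Finite ∧ a ∉ fixator F := by
  by_contra! hc
  refine h (eq_one_of_smul fun ξ => ext_ray fun n => ?_)
  exact mem_cyl_ray_iff.1 ((smul_mem_cyl_iff (hc {ξ.ray n} (Set.finite_singleton _)) rfl).2
    (mem_cyl_ray ξ n))

instance : T2Space (Neretin d k) := by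
  refine IsTopologicalGroup.t2Space_of_one_sep fun a ha => ?_
  obtain ⟨F, hF, h⟩ := exists_notMem_fixator ha
  exact ⟨_, fixator_mem_nhds_one hF, h⟩

theorem coset_mem_nhds {F : Set (Vertex d k)} (hF : F.Finite) (g : Neretin d k) :
    {g' | g⁻¹ * g' ∈ fixator F} ∈ 𝓝 g :=
  ((isOpen_fixator hF).preimage (continuous_const_mul g⁻¹)).mem_nhds (by simp [one_mem])

instance : ContinuousSMul (Neretin d k) (Ends d k) where
  continuous_smul := by
    refine continuous_def.2 fun U hU => isOpen_iff_mem_nhds.2 ?_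
    rintro ⟨g, ξ⟩ h
    obtain ⟨n, hn⟩ := exists_cyl_subset (hU.preimage g.toHomeo.continuous) h
    filter_upwards [prod_mem_nhds (coset_mem_nhds (Set.finite_singleton (ξ.ray n)) g)
      ((isClopen_cyl _).2.mem_nhds (mem_cyl_ray ξ n))] with p hp
    have := hn ((smul_mem_cyl_iff hp.1 rfl).2 hp.2)
    change g • ((g⁻¹ * p.1) • p.2) ∈ U at this
    rwa [smul_smul, mul_inv_cancel_left] at this

/-- The stabilizer of a clopen set is open. -/
theorem exists_fixator_smul_eq {U : Set (Ends d k)} (hU : IsClopen U) :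
    ∃ F : Set (Vertex d k), F.Finite ∧ ∀ a ∈ fixator F, a • U = U := by
  obtain ⟨n, hn⟩ := exists_level_of_isClopen hU
  have hF := Vertex.finite_level_eq (d := d) (k := k) n
  have key : ∀ a ∈ fixator {v : Vertex d k | v.level = n}, a • U ⊆ U := by
    rintro a ha _ ⟨ξ, hξ, rfl⟩
    refine hn _ _ ?_ hξ
    exact (mem_cyl_ray_iff.1 ((smul_mem_cyl_iff ha (level_ray _ _)).2 (mem_cyl_ray ξ n))).symm
  refine ⟨_, hF, fun a ha => (key a ha).antisymm ?_⟩
  rw [Set.subset_smul_set_iff]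
  exact key _ (inv_mem ha)

/-! ### Elements of bounded complexity -/

/-- `g` maps every cylinder of level at least `N` onto a cylinder, compatibly with the tree
structure below level `N`, and changes levels by at most `M`. -/
def IsBounded (N M : ℕ) (g : Neretin d k) : Prop :=
  ∀ ξ : Ends d k, ∃ m, m ≤ N + M ∧ N ≤ m + M ∧
    ∀ i, g • cyl (ξ.ray (N + i)) = cyl ((g • ξ).ray (m + i))

theorem IsBounded.mono {N M N' M' : ℕ} {g : Neretin d k} (h : IsBounded N M g) (hN : N ≤ N')
    (hM : M ≤ M') : IsBounded N' M' g := fun ξ => by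
  obtain ⟨m, h1, h2, h3⟩ := h ξ
  obtain ⟨j, rfl⟩ := Nat.exists_eq_add_of_le hN
  exact ⟨m + j, by omega, by omega, fun i => by rw [add_assoc, add_assoc, h3]⟩

/-- Below a sufficiently deep level the shifts of the two factors along a ray add up. -/
theorem IsBounded.mul {N₁ M₁ N₂ M₂ : ℕ} {a b : Neretin d k} (ha : IsBounded N₁ M₁ a)
    (hb : IsBounded N₂ M₂ b) : IsBounded (N₁ + N₂ + M₂) (M₁ + M₂) (a * b) := fun ξ => by
  obtain ⟨m₂, h1, h2, h3⟩ := hb ξ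
  obtain ⟨m₁, h4, h5, h6⟩ := ha (b • ξ)
  refine ⟨m₁ + m₂ + M₂, by omega, by omega, fun i => ?_⟩
  rw [mul_smul, mul_smul, show N₁ + N₂ + M₂ + i = N₂ + (N₁ + M₂ + i) by omega, h3,
    show m₂ + (N₁ + M₂ + i) = N₁ + (m₂ + M₂ + i) by omega, h6]
  congr 2; omega

theorem smul_cyl_eq_iff {g : Neretin d k} {v w : Vertex d k} :
    g • cyl v = cyl w ↔ ∀ ξ, ξ ∈ cyl v ↔ g • ξ ∈ cyl w := by
  constructor
  · intro h ξ
    rw [← h, Set.smul_mem_smul_set_iff]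
  · intro h
    ext η
    rw [Set.mem_smul_set_iff_inv_smul_mem, h, smul_inv_smul]

/-- A permutation commuting with `parent` preserves levels, so it maps cylinders to cylinders
without any shift. -/
theorem isBounded_of_mem_fixator {F : Set (Vertex d k)} {a : Neretin d k} (ha : a ∈ fixator F) :
    IsBounded 0 0 a := fun ξ => by
  obtain ⟨σ, hσ, -, i⟩ := ha
  have hl : ∀ n, (σ (ξ.ray n)).level = n := fun n => by
    induction n with
    | zero =>
      rw [ray_zero]
      have : (σ .root).parent = σ .root := hσ .root
      by_contra hne
      have h1 : σ .root ≠ .root := fun h => hne (by rw [h]; rfl)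
      have := Vertex.level_parent h1
      rw [‹(σ .root).parent = σ .root›] at this
      omega
    | succ n ih =>
      have h1 := hσ (ξ.ray (n + 1))
      rw [parent_ray] at h1
      have h2 : σ (ξ.ray (n + 1)) ≠ .root := fun h => by
        have h3 := congrArg Vertex.level h1
        rw [h, ih] at h3
        have h4 : n = 0 := h3.symm
        subst h4
        rw [h, ray_zero] at h1
        have h5 : ξ.ray 1 = ξ.ray 0 := σ.injective (by rw [ray_zero, ← h1]; exact h)
        have := congrArg Vertex.level h5
        simp [level_ray] at this
      rw [Vertex.level_parent h2, h1, ih]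
  refine ⟨0, le_rfl, le_rfl, fun n => ?_⟩
  have h := (i (ξ.ray (0 + n)) trivial ξ).1 (mem_cyl_ray _ _)
  rw [mem_cyl_iff, hl] at h
  rw [smul_cyl_eq_iff, smul_def, h]
  exact i _ trivial

/-- Outside a finite subtree the forest isomorphism respects children, so along each ray it shifts
levels by a constant. The constant depends only on the vertex of level `N`, and there are finitely
many of these. -/
theorem exists_isBounded (g : Neretin d k) : ∃ N M, IsBounded N M g := by
  obtain ⟨A, B, φ, h, hg⟩ := g.2
  obtain ⟨N, hN⟩ : ∃ N, ∀ v ∈ A, v.level < N := by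
    obtain ⟨N, hN⟩ := (h.left.finite.image Vertex.level).bddAbove
    exact ⟨N + 1, fun v hv => Nat.lt_succ_of_le (hN ⟨v, hv, rfl⟩)⟩
  obtain ⟨M, hM⟩ := ((Vertex.finite_level_eq (d := d) (k := k) N).image
    fun v => (φ v).level).bddAbove
  refine ⟨N, N + M, fun ξ => ⟨(φ (ξ.ray N)).level, ?_, by omega, ?_⟩⟩
  · have : (φ (ξ.ray N)).level ≤ M := hM ⟨_, level_ray _ _, rfl⟩
    omega
  have hA : ∀ i, ξ.ray (N + i) ∉ A := fun i hi => by
    have := hN _ hi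
    rw [level_ray] at this
    omega
  have hl : ∀ i, (φ (ξ.ray (N + i))).level = (φ (ξ.ray N)).level + i := fun i => by
    induction i with
    | zero => rfl
    | succ i ih =>
      have h1 := (h.parent_iff _ (hA i) _ (hA (i + 1))).1 (parent_ray _ _)
      have h2 : φ (ξ.ray (N + (i + 1))) ≠ .root := fun h0 =>
        h.map_notMem (hA (i + 1)) (h0 ▸ h.right.root_mem)
      rw [Vertex.level_parent h2, h1, ih]
      rfl
  intro i
  have h1 := (hg _ (hA i) ξ).1 (mem_cyl_ray _ _)
  rw [mem_cyl_iff, hl] at h1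
  rw [smul_cyl_eq_iff]
  change ∀ ζ, _ ↔ g.toHomeo ζ ∈ cyl ((g.toHomeo ξ).ray _)
  erw [h1]
  exact hg _ (hA i)

/-- An element that preserves all cylinders below the level `N` up to tree automorphisms and
all cylinders of level `N` fixes all vertices of level at most `N`. -/
theorem mem_fixator_of_smul_cyl {N : ℕ} {g : Neretin d k}
    (h : ∀ ξ : Ends d k, ∀ i, g • cyl (ξ.ray (N + i)) = cyl ((g • ξ).ray (N + i)))
    (hN : ∀ ξ : Ends d k, (g • ξ).ray N = ξ.ray N) (hne : ∀ v : Vertex d k, (cyl v).Nonempty)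
    {F : Set (Vertex d k)} (hF : ∀ v ∈ F, v.level ≤ N) : g ∈ fixator F := by
  have hN' : ∀ {n} (_ : n ≤ N) (ξ : Ends d k), (g • ξ).ray n = ξ.ray n := fun hn ξ =>
    ray_eq_of_le (hN ξ) hn
  have h' : ∀ (ξ : Ends d k) n, g • cyl (ξ.ray n) = cyl ((g • ξ).ray n) := fun ξ n => by
    rcases le_total N n with hn | hn
    · obtain ⟨i, rfl⟩ := Nat.exists_eq_add_of_le hn
      exact h ξ i
    · rw [smul_cyl_eq_iff]
      intro ζ
      rw [mem_cyl_ray_iff, mem_cyl_ray_iff, hN' hn, hN' hn]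
  -- The vertex permutation is read off from the action on one chosen end through each vertex.
  choose e he using hne
  let σ : Vertex d k → Vertex d k := fun v => (g • e v).ray v.level
  have hσl : ∀ v, (σ v).level = v.level := fun v => level_ray _ _
  have hσ : ∀ v, g • cyl v = cyl (σ v) := fun v => by
    have := h' (e v) v.level
    rwa [mem_cyl_iff.1 (he v)] at this
  have huniq : ∀ {v w : Vertex d k} {ξ}, ξ ∈ cyl v → ξ ∈ cyl w → v.level = w.level → v = w :=
    fun h1 h2 h3 => by rw [← mem_cyl_iff.1 h1, ← mem_cyl_iff.1 h2, h3]
  have hmem : ∀ {v ξ}, ξ ∈ cyl v ↔ g • ξ ∈ cyl (σ v) := fun {v ξ} => smul_cyl_eq_iff.1 (hσ v) ξ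
  have hinj : Function.Injective σ := fun v w hvw => by
    have h1 := hmem.1 (he v)
    rw [hvw, ← hmem] at h1
    exact huniq (he v) h1 (by rw [← hσl v, hvw, hσl])
  have hsurj : Function.Surjective σ := fun w => by
    refine ⟨(g⁻¹ • e w).ray w.level, huniq (hmem.1 (mem_cyl_ray (g⁻¹ • e w) w.level)) ?_ ?_⟩
    · rw [smul_inv_smul]; exact he w
    · rw [hσl, level_ray]
  refine ⟨Equiv.ofBijective σ ⟨hinj, hsurj⟩, fun v => ?_, fun v hv => ?_, fun v _ ξ => hmem⟩
  · change (σ v).parent = σ v.parent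
    refine huniq (mem_cyl_parent (hmem.1 (he v))) (hmem.1 (mem_cyl_parent (he v))) ?_
    rw [Vertex.level_parent_eq, hσl, hσl, Vertex.level_parent_eq]
  · change (g • e v).ray v.level = v
    rw [hN' (hF v hv)]
    exact mem_cyl_iff.1 (he v)

end Neretin

/-! ### The homeomorphism induced by an almost automorphism -/

namespace IsAlmostAutomorphism

variable {d k : ℕ} {A B : Set (Vertex d k)} {φ : PartialEquiv (Vertex d k) (Vertex d k)}

open Ends

/-- The tail of the ray lies outside `A`, and its image is a descending path, which converges to an
end. Going back up along parents covers the earlier vertices outside `A`. -/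
theorem exists_end (h : IsAlmostAutomorphism A B φ) (ξ : Ends d k) :
    ∃ η : Ends d k, ∀ v ∉ A, ξ ∈ cyl v → η ∈ cyl (φ v) := by
  obtain ⟨N, hN⟩ := h.left.finite.image Vertex.level |>.bddAbove
  have hA : ∀ n, ξ.ray (N + 1 + n) ∉ A := fun n hn => by
    have := hN ⟨_, hn, rfl⟩
    rw [level_ray] at this
    omega
  have hstep : ∀ n, ξ.ray n ∉ A → ξ.ray (n + 1) ∉ A := fun n hn h1 => by
    have := h.left.parent_mem _ h1
    rw [parent_ray] at this
    exact hn this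
  have hpar : ∀ n, ξ.ray n ∉ A → φ (ξ.ray (n + 1)) ≠ .root ∧
      (φ (ξ.ray (n + 1))).parent = φ (ξ.ray n) := fun n hn =>
    ⟨fun h0 => h.map_notMem (hstep n hn) (h0 ▸ h.right.root_mem),
      (h.parent_iff _ hn _ (hstep n hn)).1 (parent_ray _ _)⟩
  obtain ⟨η, hη⟩ := exists_of_path (fun n => φ (ξ.ray (N + 1 + n))) fun n => hpar _ (hA n)
  refine ⟨η, ?_⟩
  have hstep' : ∀ j n, ξ.ray n ∉ A → η ∈ cyl (φ (ξ.ray (n + j))) → η ∈ cyl (φ (ξ.ray n)) := by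
    intro j
    induction j with
    | zero => exact fun n _ h => h
    | succ j ih =>
      intro n hn h1
      rw [← (hpar n hn).2]
      exact mem_cyl_parent (ih _ (hstep n hn) (by rwa [add_right_comm, add_assoc]))
  rintro v hv ⟨n, rfl⟩
  refine hstep' (N + 1) n hv ?_
  rw [add_comm n]
  exact hη n

theorem induces (h : IsAlmostAutomorphism A B φ) :
    ∃ g : Neretin d k, Induces Aᶜ φ g.toHomeo := by
  choose f hf using h.exists_end
  choose f' hf' using h.symm.exists_end
  have key : ∀ {A B : Set (Vertex d k)} {φ : PartialEquiv (Vertex d k) (Vertex d k)}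
      (_ : IsAlmostAutomorphism A B φ) {f f' : Ends d k → Ends d k},
      (∀ ξ, ∀ v ∉ A, ξ ∈ cyl v → f ξ ∈ cyl (φ v)) →
      (∀ ξ, ∀ v ∉ B, ξ ∈ cyl v → f' ξ ∈ cyl (φ.symm v)) → Function.LeftInverse f' f := by
    intro A B φ h f f' hf hf' ξ
    refine ext_ray fun n => ?_
    obtain ⟨m, hm⟩ := ξ.exists_ray_notMem h.left.finite n
    have := hf' _ _ (h.map_notMem hm) (hf ξ _ hm (mem_cyl_ray _ _))
    rw [h.left_inv hm, mem_cyl_ray_iff] at this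
    exact ray_eq_of_le this (by omega)
  have hl := key h hf hf'
  have hr : Function.RightInverse f' f := key h.symm hf' fun ξ v hv => hf ξ v hv
  have hiff : ∀ v ∉ A, ∀ ξ : Ends d k, ξ ∈ cyl v ↔ f ξ ∈ cyl (φ v) := fun v hv ξ =>
    ⟨hf ξ v hv, fun h1 => by
      have := hf' _ _ (h.map_notMem hv) h1
      rwa [h.left_inv hv, hl] at this⟩
  have hcont : Continuous f := by
    refine continuous_def.2 fun U hU => isOpen_iff_mem_nhds.2 fun ξ hξ => ?_
    obtain ⟨n, hn⟩ := exists_cyl_subset hU hξ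
    obtain ⟨m, hm, hB⟩ : ∃ m, n ≤ m ∧ (f ξ).ray m ∉ B := by
      obtain ⟨m, hm⟩ := (f ξ).exists_ray_notMem h.right.finite n
      exact ⟨_, by omega, hm⟩
    have h1 : ξ ∈ cyl (φ.symm ((f ξ).ray m)) := by
      rw [hiff _ (h.symm_notMem hB), h.right_inv hB]
      exact mem_cyl_ray _ _
    filter_upwards [(isClopen_cyl _).2.mem_nhds h1] with ζ hζ
    rw [hiff _ (h.symm_notMem hB), h.right_inv hB] at hζ
    exact hn (cyl_ray_anti _ hm hζ)
  let g : Ends d k ≃ₜ Ends d k := hcont.homeoOfEquivCompactToT2 (f := ⟨f, f', hl, hr⟩)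
  exact ⟨⟨g, A, B, φ, h, hiff⟩, hiff⟩

end IsAlmostAutomorphism

/-! ### Exchanging two disjoint subtrees -/

namespace Vertex

variable {d k : ℕ}

/-- The descendants of a vertex `node i a`, which is a descendant of itself. -/
def below (i : Fin k) (a : List (Fin d)) : Set (Vertex d k) := {u | ∃ l, u = node i (l ++ a)}

theorem mem_below_of_parent {i : Fin k} {a : List (Fin d)} {u : Vertex d k}
    (h : u.parent ∈ below i a) : u ∈ below i a := by
  obtain ⟨l, hl⟩ := h
  rcases u with _ | ⟨i', _ | ⟨c, x⟩⟩
  · simp [parent] at hl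
  · simp [parent] at hl
  · simp only [parent, node.injEq] at hl
    obtain ⟨rfl, rfl⟩ := hl
    exact ⟨c :: l, rfl⟩

theorem mem_below_of_iterate_parent {i : Fin k} {a : List (Fin d)} {u : Vertex d k} (n : ℕ)
    (h : parent^[n] u ∈ below i a) : u ∈ below i a := by
  induction n generalizing u with
  | zero => exact h
  | succ n ih => exact mem_below_of_parent (ih h)

theorem eq_or_parent_mem_below {i : Fin k} {a : List (Fin d)} {u : Vertex d k}
    (h : u ∈ below i a) : u = node i a ∨ ∃ c l, u = node i (c :: l ++ a) := by
  obtain ⟨_ | ⟨c, l⟩, rfl⟩ := h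
  · exact Or.inl rfl
  · exact Or.inr ⟨c, l, rfl⟩

theorem mem_cyl_of_ray_mem_below {i : Fin k} {a : List (Fin d)} {ξ : Ends d k} {n : ℕ}
    (h : ξ.ray n ∈ below i a) : ξ ∈ Ends.cyl (node i a) := by
  obtain ⟨l, hl⟩ := h
  have : ξ ∈ Ends.cyl (node i (l ++ a)) := ⟨n, hl⟩
  clear hl
  induction l with
  | nil => exact this
  | cons c l ih => exact ih (Ends.mem_cyl_parent this)

/-- The strict ancestors of a vertex. -/
def above (v : Vertex d k) : Set (Vertex d k) := {u | ∃ n, u = parent^[n + 1] v}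

theorem finite_above (v : Vertex d k) : (above v).Finite := by
  refine ((Set.finite_le_nat v.level).biUnion fun n _ => finite_level_eq n).subset ?_
  rintro _ ⟨n, rfl⟩
  exact Set.mem_iUnion₂.2 ⟨(parent^[n + 1] v).level,
    (level_iterate_parent v (n + 1)).trans_le (Nat.sub_le _ _), rfl⟩

theorem isFiniteSubtree_above (v w : Vertex d k) :
    IsFiniteSubtree (above v ∪ above w) where
  finite := (finite_above v).union (finite_above w)
  root_mem := by
    refine Or.inl ⟨v.level - 1, ?_⟩
    symm
    rw [← level_eq_zero_iff, level_iterate_parent]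
    omega
  parent_mem := by
    rintro _ (⟨n, rfl⟩ | ⟨n, rfl⟩)
    · exact Or.inl ⟨n + 1, by rw [Function.iterate_succ_apply' _ (n + 1)]⟩
    · exact Or.inr ⟨n + 1, by rw [Function.iterate_succ_apply' _ (n + 1)]⟩

open Classical in
/-- The map of vertices that exchanges the subtrees at `node i a` and `node j b`. -/
noncomputable def swapFun (i : Fin k) (a : List (Fin d)) (j : Fin k) (b : List (Fin d))
    (u : Vertex d k) : Vertex d k :=
  if h : ∃ l, u = node i (l ++ a) then node j (h.choose ++ b)
  else if h : ∃ l, u = node j (l ++ b) then node i (h.choose ++ a) else u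

section swap

variable {i j : Fin k} {a b : List (Fin d)}

theorem swapFun_left (l : List (Fin d)) :
    swapFun i a j b (node i (l ++ a)) = node j (l ++ b) := by
  have h : ∃ l', (node i (l ++ a) : Vertex d k) = node i (l' ++ a) := ⟨l, rfl⟩
  have := List.append_cancel_right (node.inj h.choose_spec).2
  rw [swapFun, dif_pos h, ← this]

theorem swapFun_right (hd : Disjoint (below i a) (below j b)) (l : List (Fin d)) :
    swapFun i a j b (node j (l ++ b)) = node i (l ++ a) := by
  have h : ∃ l', (node j (l ++ b) : Vertex d k) = node j (l' ++ b) := ⟨l, rfl⟩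
  have h' : ¬ ∃ l', (node j (l ++ b) : Vertex d k) = node i (l' ++ a) :=
    hd.notMem_of_mem_right h
  have := List.append_cancel_right (node.inj h.choose_spec).2
  rw [swapFun, dif_neg h', dif_pos h, ← this]

theorem swapFun_of_notMem {u : Vertex d k} (h : u ∉ below i a) (h' : u ∉ below j b) :
    swapFun i a j b u = u :=
  (dif_neg h).trans (dif_neg h')

theorem swapFun_swapFun (hd : Disjoint (below i a) (below j b)) (u : Vertex d k) :
    swapFun i a j b (swapFun i a j b u) = u := by
  by_cases h : u ∈ below i a
  · obtain ⟨l, rfl⟩ := h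
    rw [swapFun_left, swapFun_right hd]
  by_cases h' : u ∈ below j b
  · obtain ⟨l, rfl⟩ := h'
    rw [swapFun_right hd, swapFun_left]
  · rw [swapFun_of_notMem h h', swapFun_of_notMem h h']

theorem disjoint_below_above (hd : Disjoint (below i a) (below j b)) :
    Disjoint (below i a) (above (node i a) ∪ above (node j b)) := by
  rw [Set.disjoint_left]
  rintro u hu (⟨n, rfl⟩ | ⟨n, rfl⟩)
  · obtain ⟨l, hl⟩ := hu
    have := congrArg level hl
    rw [level_iterate_parent] at this
    simp only [level, List.length_append] at this
    omega
  · exact Set.disjoint_left.1 hd (mem_below_of_iterate_parent _ hu) ⟨[], rfl⟩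

theorem swapFun_notMem_above (hd : Disjoint (below i a) (below j b)) {u : Vertex d k}
    (hu : u ∉ above (node i a) ∪ above (node j b)) :
    swapFun i a j b u ∉ above (node i a) ∪ above (node j b) := by
  by_cases h : u ∈ below i a
  · obtain ⟨l, rfl⟩ := h
    rw [swapFun_left, Set.union_comm]
    exact Set.disjoint_left.1 (disjoint_below_above hd.symm) ⟨l, rfl⟩
  by_cases h' : u ∈ below j b
  · obtain ⟨l, rfl⟩ := h'
    rw [swapFun_right hd]
    exact Set.disjoint_left.1 (disjoint_below_above hd) ⟨l, rfl⟩
  · rwa [swapFun_of_notMem h h']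

theorem parent_swapFun (hd : Disjoint (below i a) (below j b)) {u : Vertex d k}
    (hp : u.parent ∉ above (node i a) ∪ above (node j b)) :
    (swapFun i a j b u).parent = swapFun i a j b u.parent := by
  by_cases h : u ∈ below i a
  · obtain rfl | ⟨c, l, rfl⟩ := eq_or_parent_mem_below h
    · exact absurd (Or.inl ⟨0, rfl⟩) hp
    · rw [swapFun_left]
      exact (swapFun_left l).symm
  by_cases h' : u ∈ below j b
  · obtain rfl | ⟨c, l, rfl⟩ := eq_or_parent_mem_below h'
    · exact absurd (Or.inr ⟨0, rfl⟩) hp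
    · rw [swapFun_right hd]
      exact (swapFun_right hd l).symm
  · rw [swapFun_of_notMem h h', swapFun_of_notMem (fun h1 => h (mem_below_of_parent h1))
      fun h1 => h' (mem_below_of_parent h1)]

/-- The exchange breaks the parent relation only at the roots of the two subtrees, so it suffices to
remove their strict ancestors. -/
theorem isAlmostAutomorphism_swapFun (hd : Disjoint (below i a) (below j b)) :
    IsAlmostAutomorphism (above (node i a) ∪ above (node j b))
      (above (node i a) ∪ above (node j b))
      ⟨swapFun i a j b, swapFun i a j b, (above (node i a) ∪ above (node j b))ᶜ,
        (above (node i a) ∪ above (node j b))ᶜ, fun _ h => swapFun_notMem_above hd h,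
        fun _ h => swapFun_notMem_above hd h, fun u _ => swapFun_swapFun hd u,
        fun u _ => swapFun_swapFun hd u⟩ where
  left := isFiniteSubtree_above _ _
  right := isFiniteSubtree_above _ _
  source_eq := rfl
  target_eq := rfl
  parent_iff := by
    intro v hv w hw
    change w.parent = v ↔ (swapFun i a j b w).parent = swapFun i a j b v
    constructor
    · rintro rfl
      exact parent_swapFun hd hv
    · intro h
      have := parent_swapFun hd (u := swapFun i a j b w)
        (by rw [h]; exact swapFun_notMem_above hd hv)
      rwa [h, swapFun_swapFun hd, swapFun_swapFun hd] at this

end swap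

end Vertex

/-! ### Compression of clopen sets -/

namespace Neretin

variable {d k : ℕ}

open Ends

/-- The element of the Neretin group that exchanges two disjoint cylinders. -/
theorem exists_swap (hd : 2 ≤ d) (hk : 2 ≤ k) {v w : Vertex d k} (h : Disjoint (cyl v) (cyl w)) :
    ∃ s : Neretin d k, s • cyl v = cyl w ∧ ∀ ξ, ξ ∉ cyl v → ξ ∉ cyl w → s • ξ = ξ := by
  have hroot : ∀ ξ : Ends d k, ξ ∈ cyl .root := fun ξ => ⟨0, ray_zero ξ⟩
  rcases v with _ | ⟨i, a⟩
  · obtain ⟨ξ, hξ⟩ := nonempty_cyl hd hk w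
    exact absurd hξ (Set.disjoint_left.1 h (hroot ξ))
  rcases w with _ | ⟨j, b⟩
  · obtain ⟨ξ, hξ⟩ := nonempty_cyl hd hk (.node i a)
    exact absurd (hroot ξ) (Set.disjoint_left.1 h hξ)
  have hb : Disjoint (Vertex.below i a) (Vertex.below j b) := by
    rw [Set.disjoint_left]
    intro u hu hu'
    obtain ⟨ξ, n, rfl⟩ := nonempty_cyl hd hk u
    exact Set.disjoint_left.1 h (Vertex.mem_cyl_of_ray_mem_below hu)
      (Vertex.mem_cyl_of_ray_mem_below hu')
  have haa := Vertex.isAlmostAutomorphism_swapFun hb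
  obtain ⟨s, hs⟩ := haa.induces
  refine ⟨s, ?_, fun ξ h1 h2 => ext_ray fun n => ?_⟩
  · rw [smul_cyl_eq_iff]
    have := hs (.node i a) (Set.disjoint_left.1 (Vertex.disjoint_below_above hb) ⟨[], rfl⟩)
    have h0 := Vertex.swapFun_left (i := i) (j := j) (a := a) (b := b) []
    simp only [List.nil_append] at h0
    change ∀ ξ, _ ↔ s.toHomeo ξ ∈ cyl (Vertex.swapFun i a j b (.node i a)) at this
    rw [h0] at this
    exact this
  · obtain ⟨m, hm⟩ := ξ.exists_ray_notMem haa.left.finite n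
    have := (hs _ hm ξ).1 (mem_cyl_ray _ _)
    change s • ξ ∈ cyl (Vertex.swapFun i a j b _) at this
    rw [Vertex.swapFun_of_notMem (fun h => h1 (Vertex.mem_cyl_of_ray_mem_below h))
      fun h => h2 (Vertex.mem_cyl_of_ray_mem_below h), mem_cyl_ray_iff] at this
    exact ray_eq_of_le this (by omega)

theorem exists_disjoint_cyl (hd : 2 ≤ d) (hk : 2 ≤ k) (v : Vertex d k) :
    ∃ u u' : Vertex d k, cyl u ⊆ cyl v ∧ cyl u' ⊆ cyl v ∧ Disjoint (cyl u) (cyl u') := by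
  obtain ⟨u, u', hne, hu, hu', hr, hr'⟩ := Vertex.exists_child hd hk v
  refine ⟨u, u', fun ξ h => hu ▸ mem_cyl_parent h, fun ξ h => hu' ▸ mem_cyl_parent h, ?_⟩
  rw [Set.disjoint_left]
  intro ξ h h'
  apply hne
  rw [← mem_cyl_iff.1 h, ← mem_cyl_iff.1 h', Vertex.level_parent hr, Vertex.level_parent hr', hu,
    hu']

/-- Room is made inside `z` by passing to two disjoint subcylinders: one receives the cylinders
treated so far by induction, the other is exchanged with the new one. -/
theorem exists_compress_finset (hd : 2 ≤ d) (hk : 2 ≤ k) (T : Finset (Vertex d k))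
    (hT : (T : Set (Vertex d k)).PairwiseDisjoint cyl) (z : Vertex d k)
    (hz : ∀ v ∈ T, Disjoint (cyl v) (cyl z)) :
    ∃ s : Neretin d k, (∀ ξ, ξ ∉ cyl z → (∀ v ∈ T, ξ ∉ cyl v) → s • ξ = ξ) ∧
      ∀ v ∈ T, s • cyl v ⊆ cyl z := by
  classical
  induction T using Finset.induction_on generalizing z with
  | empty => exact ⟨1, fun ξ _ _ => one_smul _ ξ, by simp⟩
  | insert v T hv ih =>
    obtain ⟨u, u', hu, hu', huu⟩ := exists_disjoint_cyl hd hk z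
    obtain ⟨s, hs, hs'⟩ := ih (hT.subset (by simp)) u
      fun w hw => (hz w (by simp [hw])).mono_right hu
    have hvz := hz v (by simp)
    obtain ⟨t, ht, ht'⟩ := exists_swap hd hk (hvz.mono_right hu')
    refine ⟨t * s, fun ξ h1 h2 => ?_, fun w hw => ?_⟩
    · rw [mul_smul, hs ξ (fun h => h1 (hu h)) fun w hw => h2 w (by simp [hw])]
      exact ht' ξ (h2 v (by simp)) fun h => h1 (hu' h)
    · rw [mul_smul]
      obtain rfl | hw := Finset.mem_insert.1 hw
      · refine Set.Subset.trans ?_ hu'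
        rw [← ht, Set.smul_set_subset_smul_set_iff]
        rintro _ ⟨ξ, hξ, rfl⟩
        have : s • ξ = ξ := hs ξ (fun h => Set.disjoint_left.1 hvz hξ (hu h)) fun w' hw' h' =>
          Set.disjoint_left.1 (hT (x := w) (by simp) (y := w') (by simp [hw'])
            fun h => hv (by rwa [h])) hξ h'
        rwa [← this] at hξ
      · rintro _ ⟨η, hη, rfl⟩
        have hηu := hs' w hw hη
        have : t • η = η := ht' η (fun h => Set.disjoint_left.1 hvz h (hu hηu)) fun h =>
          Set.disjoint_left.1 huu hηu h
        simpa only [this] using hu hηu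

/-- A clopen set can be pushed into any disjoint cylinder. -/
theorem exists_compress (hd : 2 ≤ d) (hk : 2 ≤ k) {B : Set (Ends d k)} (hB : IsClopen B)
    {z : Vertex d k} (hz : Disjoint B (cyl z)) :
    ∃ s : Neretin d k, (∀ ξ, ξ ∉ cyl z → ξ ∉ B → s • ξ = ξ) ∧ s • B ⊆ cyl z := by
  obtain ⟨n, hn⟩ := exists_level_of_isClopen hB
  have hfin : {v : Vertex d k | v.level = n ∧ cyl v ⊆ B}.Finite :=
    (Vertex.finite_level_eq n).subset fun v hv => hv.1
  obtain ⟨s, hs, hs'⟩ := exists_compress_finset hd hk hfin.toFinset (by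
      intro v hv w hw hne
      simp only [Set.Finite.coe_toFinset, Set.mem_ofPred_eq] at hv hw
      refine Set.disjoint_left.2 fun ξ h h' => hne ?_
      rw [← mem_cyl_iff.1 h, ← mem_cyl_iff.1 h', hv.1, hw.1]) z
    (fun v hv => by
      simp only [Set.Finite.mem_toFinset, Set.mem_ofPred_eq] at hv
      exact hz.mono_left hv.2)
  refine ⟨s, fun ξ h1 h2 => hs ξ h1 fun v hv h => h2 ?_, ?_⟩
  · simp only [Set.Finite.mem_toFinset, Set.mem_ofPred_eq] at hv
    exact hv.2 h
  · rintro _ ⟨ξ, hξ, rfl⟩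
    refine hs' (ξ.ray n) ?_ (Set.smul_mem_smul_set (mem_cyl_ray ξ n))
    simp only [Set.Finite.mem_toFinset, Set.mem_ofPred_eq]
    exact ⟨level_ray _ _, fun η hη => hn ξ η (mem_cyl_ray_iff.1 hη).symm hξ⟩

/-- Of two disjoint subcylinders, one carries at most half of the mass. -/
theorem exists_small_cyl [MeasurableSpace (Ends d k)] [BorelSpace (Ends d k)] (hd : 2 ≤ d)
    (hk : 2 ≤ k) (μ : MeasureTheory.Measure (Ends d k)) [MeasureTheory.IsFiniteMeasure μ]
    (v : Vertex d k) : ∃ u, cyl u ⊆ cyl v ∧ μ.real (cyl u) ≤ μ.real (cyl v) / 2 := by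
  obtain ⟨u, u', hu, hu', huu⟩ := exists_disjoint_cyl hd hk v
  have h1 : μ.real (cyl u ∪ cyl u') ≤ μ.real (cyl v) :=
    MeasureTheory.measureReal_mono (Set.union_subset hu hu')
  rw [MeasureTheory.measureReal_union huu (isClopen_cyl u').2.measurableSet] at h1
  by_cases h : μ.real (cyl u) ≤ μ.real (cyl v) / 2
  · exact ⟨u, hu, h⟩
  · exact ⟨u', hu', by linarith⟩

/-- Every probability measure on a clopen set can be mostly moved into the preimage of
a given non-empty clopen subset, by an element supported in the clopen set. -/
theorem exists_contraction [MeasurableSpace (Ends d k)] [BorelSpace (Ends d k)] (hd : 2 ≤ d)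
    (hk : 2 ≤ k) (μ : MeasureTheory.Measure (Ends d k)) [MeasureTheory.IsProbabilityMeasure μ]
    {E A : Set (Ends d k)} (hE : IsClopen E) (hA : IsClopen A) (hAE : A ⊆ E) (hne : A.Nonempty)
    (hμ : μ.real E = 1) :
    ∃ s : Neretin d k, (∀ ξ ∉ E, s • ξ = ξ) ∧ 1 / 2 < μ.real (s • A) := by
  obtain ⟨ξ, hξ⟩ := hne
  obtain ⟨n, hn⟩ := exists_cyl_subset hA.2 hξ
  -- Halving twice gives a cylinder `z` in `A` of mass at most 1/4. Once `E \ A` is pushed into `z`,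
  -- the image of `A` keeps mass at least 3/4.
  obtain ⟨u, hu, hu2⟩ := exists_small_cyl hd hk μ (ξ.ray n)
  obtain ⟨z, hz, hz2⟩ := exists_small_cyl hd hk μ u
  have hzA : cyl z ⊆ A := (hz.trans hu).trans hn
  obtain ⟨s, hs, hs'⟩ := exists_compress hd hk (hE.diff hA) (z := z)
    (Set.disjoint_left.2 fun ζ h h' => h.2 (hzA h'))
  have hsE : ∀ ξ ∉ E, s • ξ = ξ := fun ξ h => hs ξ (fun h' => h (hAE (hzA h'))) fun h' => h h'.1
  refine ⟨s, hsE, ?_⟩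
  have hsub : E ⊆ s • A ∪ s • (E \ A) := by
    rw [← Set.smul_set_union, Set.union_sdiff_cancel hAE]
    intro ζ hζ
    rw [Set.mem_smul_set_iff_inv_smul_mem]
    by_contra h
    have := hsE _ h
    rw [smul_inv_smul] at this
    exact h (this ▸ hζ)
  have h1 := (MeasureTheory.measureReal_mono (μ := μ) hsub).trans
    (MeasureTheory.measureReal_union_le _ _)
  have h2 : μ.real (s • (E \ A)) ≤ μ.real (cyl z) := MeasureTheory.measureReal_mono hs'
  have h3 : μ.real (cyl (ξ.ray n)) ≤ 1 := MeasureTheory.measureReal_le_one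
  linarith

end Neretin

/-! ### Invariant systems of measures and their concentration -/

namespace Neretin

variable {d k : ℕ}

open Ends MeasureTheory

/-- The choice functions on the non-empty clopen sets of ends. -/
def ClopenChoice (d k : ℕ) : Type :=
  {c : {U : Set (Ends d k) // IsClopen U ∧ U.Nonempty} → Ends d k // ∀ U, c U ∈ U.1}

namespace ClopenChoice

theorem isClopen_smul (g : Neretin d k) {U : Set (Ends d k)} (h : IsClopen U) :
    IsClopen (g • U) := ⟨h.1.smul g, h.2.smul g⟩

instance : MulAction (Neretin d k) {U : Set (Ends d k) // IsClopen U ∧ U.Nonempty} where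
  smul g U := ⟨g • U.1, isClopen_smul g U.2.1, U.2.2.smul_set⟩
  one_smul U := Subtype.ext (one_smul _ U.1)
  mul_smul g g' U := Subtype.ext (mul_smul g g' U.1)

instance : TopologicalSpace (ClopenChoice d k) := inferInstanceAs (TopologicalSpace (Subtype _))

instance : T2Space (ClopenChoice d k) := inferInstanceAs (T2Space (Subtype _))

instance : CompactSpace (ClopenChoice d k) := by
  refine isCompact_iff_compactSpace.1 (?_ : IsCompact
    {c : {U : Set (Ends d k) // IsClopen U ∧ U.Nonempty} → Ends d k | ∀ U, c U ∈ U.1})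
  convert isCompact_univ_pi fun U : {U : Set (Ends d k) // IsClopen U ∧ U.Nonempty} =>
    U.2.1.1.isCompact using 1
  ext c; simp

instance : Nonempty (ClopenChoice d k) := ⟨⟨fun U => U.2.2.choose, fun U => U.2.2.choose_spec⟩⟩

instance : MeasurableSpace (ClopenChoice d k) := borel _

instance : BorelSpace (ClopenChoice d k) := ⟨rfl⟩

instance : MulAction (Neretin d k) (ClopenChoice d k) where
  smul g c := ⟨fun U => g • c.1 (g⁻¹ • U), fun U => by
    rw [← Set.mem_inv_smul_set_iff]
    exact c.2 (g⁻¹ • U)⟩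
  one_smul c := Subtype.ext (funext fun U => by
    change (1 : Neretin d k) • c.1 ((1 : Neretin d k)⁻¹ • U) = c.1 U
    rw [inv_one, one_smul, one_smul])
  mul_smul g g' c := Subtype.ext (funext fun U => by
    change (g * g') • c.1 ((g * g')⁻¹ • U) = g • g' • c.1 (g'⁻¹ • g⁻¹ • U)
    rw [mul_inv_rev, mul_smul, mul_smul])

theorem smul_apply (g : Neretin d k) (c : ClopenChoice d k)
    (U : {U : Set (Ends d k) // IsClopen U ∧ U.Nonempty}) :
    (g • c).1 U = g • c.1 (g⁻¹ • U) := rfl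

/-- The end chosen in a clopen set. -/
def eval (U : {U : Set (Ends d k) // IsClopen U ∧ U.Nonempty}) (c : ClopenChoice d k) :
    Ends d k := c.1 U

theorem continuous_eval (U : {U : Set (Ends d k) // IsClopen U ∧ U.Nonempty}) :
    Continuous (eval U) :=
  (continuous_apply U).comp continuous_subtype_val

instance : ContinuousSMul (Neretin d k) (ClopenChoice d k) where
  continuous_smul := by
    refine Continuous.subtype_mk (continuous_pi fun U => continuous_iff_continuousAt.2 ?_) _
    rintro ⟨g, c⟩
    change ContinuousAt (fun p : Neretin d k × ClopenChoice d k => p.1 • p.2.1 (p.1⁻¹ • U)) (g, c)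
    -- The stabilizer of `U` is open, so `p.1⁻¹ • U` is constant for `p.1` near `g`, and only the
    -- action on ends has to be continuous.
    obtain ⟨F, hF, hU⟩ := exists_fixator_smul_eq U.2.1
    have hc : Continuous fun p : Neretin d k × ClopenChoice d k => p.1 • p.2.1 (g⁻¹ • U) :=
      continuous_fst.smul ((continuous_eval _).comp continuous_snd)
    refine hc.continuousAt.congr ?_
    have hg : {g' : Neretin d k | g' * g⁻¹ ∈ fixator F} ∈ 𝓝 g :=
      ((isOpen_fixator hF).preimage (continuous_mul_const g⁻¹)).mem_nhds (by simp [one_mem])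
    filter_upwards [prod_mem_nhds hg Filter.univ_mem] with p hp
    have : p.1⁻¹ • U = g⁻¹ • U := by
      have h1 : (p.1 * g⁻¹)⁻¹ • U = U := Subtype.ext (hU _ (inv_mem hp.1))
      rw [mul_inv_rev, inv_inv, mul_smul] at h1
      rw [← h1, inv_smul_smul, h1]
    rw [this]

end ClopenChoice

/-- A relatively amenable subgroup preserves a system of probability measures
on the clopen sets of ends. -/
theorem exists_invariant_measures [MeasurableSpace (Ends d k)] [BorelSpace (Ends d k)]
    {H : Subgroup (Neretin d k)} (hH : IsRelativelyAmenable H) :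
    ∃ μ : Set (Ends d k) → Measure (Ends d k), ∀ U, IsClopen U → U.Nonempty →
      IsProbabilityMeasure (μ U) ∧ (μ U).real U = 1 ∧
      ∀ h ∈ H, ∀ A, IsClopen A → (μ (h • U)).real (h • A) = (μ U).real A := by
  classical
  obtain ⟨m, hm, -, hinv⟩ := hH (ClopenChoice d k)
  -- The system consists of the laws of the chosen ends. The value 0 on the remaining sets is a
  -- default.
  refine ⟨fun U => if hU : IsClopen U ∧ U.Nonempty then m.map (ClopenChoice.eval ⟨U, hU⟩) else 0,
    fun U hU hne => ?_⟩
  have hmeas := fun V => (ClopenChoice.continuous_eval (d := d) (k := k) V).measurable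
  have hval : ∀ {V : Set (Ends d k)} (hV : IsClopen V ∧ V.Nonempty) {A : Set (Ends d k)},
      IsClopen A → (m.map (ClopenChoice.eval ⟨V, hV⟩)).real A =
        m.real (ClopenChoice.eval ⟨V, hV⟩ ⁻¹' A) := fun hV _ hA =>
    map_measureReal_apply (hmeas _) hA.2.measurableSet
  simp only
  rw [dif_pos ⟨hU, hne⟩]
  refine ⟨Measure.isProbabilityMeasure_map (hmeas _).aemeasurable, ?_, fun h hh A hA => ?_⟩
  · rw [hval _ hU, Set.eq_univ_of_forall (s := ClopenChoice.eval _ ⁻¹' U)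
      fun c => c.2 ⟨U, hU, hne⟩]
    exact probReal_univ
  · have hU' : IsClopen (h • U) ∧ (h • U).Nonempty :=
      ⟨ClopenChoice.isClopen_smul h hU, hne.smul_set⟩
    have hA' := ClopenChoice.isClopen_smul h hA
    rw [dif_pos hU', hval _ hA', hval _ hA]
    conv_lhs => rw [← hinv h hh]
    rw [map_measureReal_apply (continuous_const_smul h).measurable
      (hA'.2.preimage (ClopenChoice.continuous_eval _)).measurableSet]
    congr 1
    ext c
    change (h • c).1 ⟨h • U, hU'⟩ ∈ h • A ↔ c.1 ⟨U, hU, hne⟩ ∈ A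
    rw [ClopenChoice.smul_apply, Set.smul_mem_smul_set_iff]
    have : h⁻¹ • (⟨h • U, hU'⟩ : {U : Set (Ends d k) // IsClopen U ∧ U.Nonempty}) =
        ⟨U, hU, hne⟩ := Subtype.ext (inv_smul_smul h U)
    rw [this]

/-- A later correction supported in a small set `E` does not disturb sets that contain `E` or are
disjoint from it. This protects the concentration already achieved for the larger members of a
chain. -/
theorem smul_set_eq_of_supported {s : Neretin d k} {E S : Set (Ends d k)}
    (hs : ∀ ξ ∉ E, s • ξ = ξ) (h : E ⊆ S ∨ Disjoint E S) : s • S = S := by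
  have key : ∀ t : Neretin d k, (∀ ξ ∉ E, t • ξ = ξ) → t • S ⊆ S := by
    rintro t ht _ ⟨ξ, hξ, rfl⟩
    by_cases hE : ξ ∈ E
    · rcases h with h | h
      · by_contra hn
        have := ht (t • ξ) fun h' => hn (h h')
        rw [smul_left_cancel_iff] at this
        exact hn (show t • ξ ∈ S by rwa [this])
      · exact absurd hξ (Set.disjoint_left.1 h hE)
    · change t • ξ ∈ S
      rwa [ht ξ hE]
  refine (key s hs).antisymm ?_
  rw [Set.subset_smul_set_iff]
  exact key _ fun ξ hξ => by rw [inv_smul_eq_iff, hs ξ hξ]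

/-- Given a system of probability measures on the clopen sets of ends, a descending
chain of clopen sets can be moved so that the measures on its members are concentrated on
prescribed parts. -/
theorem exists_concentrating [MeasurableSpace (Ends d k)] [BorelSpace (Ends d k)] (hd : 2 ≤ d)
    (hk : 2 ≤ k) (μ : Set (Ends d k) → Measure (Ends d k))
    (hμ : ∀ U, IsClopen U → U.Nonempty → IsProbabilityMeasure (μ U) ∧ (μ U).real U = 1)
    (E A : ℕ → Set (Ends d k)) (n : ℕ)
    (hE : ∀ i < n, IsClopen (E i) ∧ IsClopen (A i) ∧ A i ⊆ E i ∧ (A i).Nonempty)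
    (hEA : ∀ j < n, ∀ i < j, E j ⊆ E i ∧ (E j ⊆ A i ∨ Disjoint (E j) (A i))) :
    ∃ f : Neretin d k, ∀ i < n, 1 / 2 < (μ (f • E i)).real (f • A i) := by
  induction n with
  | zero => exact ⟨1, fun i hi => absurd hi (Nat.not_lt_zero i)⟩
  | succ n ih =>
    obtain ⟨f, hf⟩ := ih (fun i hi => hE i (by omega)) fun j hj => hEA j (by omega)
    obtain ⟨h1, h2, h3, h4⟩ := hE n (by omega)
    obtain ⟨hp, h5⟩ := hμ (f • E n) (ClopenChoice.isClopen_smul f h1) (h4.mono h3).smul_set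
    have hm : Measurable fun ξ : Ends d k => f⁻¹ • ξ := (continuous_const_smul f⁻¹).measurable
    have hval : ∀ S : Set (Ends d k), IsClopen S →
        ((μ (f • E n)).map fun ξ => f⁻¹ • ξ).real S = (μ (f • E n)).real (f • S) :=
      fun S hS => by
        rw [map_measureReal_apply hm hS.2.measurableSet, Set.preimage_smul, inv_inv]
    have := Measure.isProbabilityMeasure_map (μ := μ (f • E n)) hm.aemeasurable
    -- The measure on `f • E n` is transported back to `E n`, so that the correction `s` is
    -- supported in `E n` and can be applied before `f`.
    obtain ⟨s, hs, hs2⟩ := exists_contraction hd hk ((μ (f • E n)).map fun ξ => f⁻¹ • ξ) h1 h2 h3 h4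
      (by rw [hval _ h1, h5])
    rw [hval _ (ClopenChoice.isClopen_smul s h2)] at hs2
    refine ⟨f * s, fun i hi => ?_⟩
    rw [mul_smul, mul_smul]
    rcases Nat.lt_succ_iff_lt_or_eq.1 hi with hi | rfl
    · obtain ⟨h6, h7⟩ := hEA n (by omega) i hi
      rw [smul_set_eq_of_supported hs (Or.inl h6), smul_set_eq_of_supported hs h7]
      exact hf i hi
    · rwa [smul_set_eq_of_supported hs (Or.inl subset_rfl)]

/-- An enumeration of the vertices of level `N`, together with an end through each of them. -/
theorem exists_enumeration (hd : 2 ≤ d) (hk : 2 ≤ k) (N : ℕ) :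
    ∃ (n : ℕ) (r : Vertex d k → ℕ) (e : ℕ → Ends d k), (∀ v, v.level = N → r v < n) ∧
      Set.InjOn r {v | v.level = N} ∧ ∀ a < n, r ((e a).ray N) = a := by
  classical
  have := (Vertex.finite_level_eq (d := d) (k := k) N).to_subtype
  obtain ⟨n, ⟨f⟩⟩ := Finite.exists_equiv_fin {v : Vertex d k | v.level = N}
  obtain ⟨ξ₀, -⟩ := nonempty_cyl hd hk (Vertex.root : Vertex d k)
  choose c hc using nonempty_cyl (d := d) (k := k) hd hk
  refine ⟨n, fun v => if h : v.level = N then f ⟨v, h⟩ else 0,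
    fun a => if h : a < n then c (f.symm ⟨a, h⟩) else ξ₀, fun v hv => ?_, fun v hv w hw h => ?_,
    fun a ha => ?_⟩
  · simp only [dif_pos hv]; exact (f _).2
  · change v.level = N at hv
    change w.level = N at hw
    simp only [dif_pos hv, dif_pos hw] at h
    exact congrArg Subtype.val (f.injective (Fin.ext h))
  · simp only [dif_pos ha, dif_pos (level_ray _ _)]
    have h1 : (f.symm ⟨a, ha⟩).1.level = N := (f.symm ⟨a, ha⟩).2
    have h2 := mem_cyl_iff.1 (hc (f.symm ⟨a, ha⟩))
    rw [h1] at h2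
    have h3 : (⟨(c (f.symm ⟨a, ha⟩)).ray N, level_ray _ _⟩ : {v : Vertex d k | v.level = N}) =
      f.symm ⟨a, ha⟩ := Subtype.ext h2
    rw [h3, Equiv.apply_symm_apply]

/-- The chain of clopen sets to which the concentration lemma is applied. -/
theorem exists_pattern [MeasurableSpace (Ends d k)] [BorelSpace (Ends d k)] (hd : 2 ≤ d)
    (hk : 2 ≤ k) (μ : Set (Ends d k) → Measure (Ends d k))
    (hμ : ∀ U, IsClopen U → U.Nonempty → IsProbabilityMeasure (μ U) ∧ (μ U).real U = 1)
    (M : ℕ) {n : ℕ} {W : ℕ → Set (Ends d k)} {P : ℕ → ℕ → Set (Ends d k)}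
    (hW : ∀ a, IsClopen (W a)) (hP : ∀ a i, IsClopen (P a i)) (hWa : Antitone W)
    (hPa : ∀ a, Antitone (P a)) (hPne : ∀ a i, (P a i).Nonempty)
    (hPs : ∀ a i, (P a i \ P a (i + 1)).Nonempty) (hPW : ∀ a < n, P a 0 ⊆ W a)
    (hdisj : ∀ a < n, Disjoint (W (a + 1)) (P a 0)) :
    ∃ f : Neretin d k, ∀ a < n,
      1 / 2 < (μ (f • W a)).real (f • P a (M + 1)) ∧
      (∀ j, 1 ≤ j → j ≤ M →
        1 / 2 < (μ (f • (W a \ P a (j + 1)))).real (f • (W a \ P a j))) ∧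
      1 / 2 < (μ (f • (W a \ P a 1))).real (f • (P a 0 \ P a 1)) := by
  -- For fixed `a` the chain is `W a`, `W a \ P a (M + 1)`, `W a \ P a M`, and so on down to `W a \
  -- P a 1`. The marked parts are `P a (M + 1)` for the first set, `W a \ P a j` for `W a \ P a (j +
  -- 1)` in between, and `P a 0 \ P a 1` for the last, which breaks the pattern on purpose. The
  -- chain for `a + 1` lives in `W (a + 1)`, which misses `P a 0`.
  let E : ℕ → ℕ → Set (Ends d k) := fun a b => W a \ if b = 0 then ∅ else P a (M + 2 - b)
  let A : ℕ → ℕ → Set (Ends d k) := fun a b =>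
    if b = 0 then P a (M + 1) else if b = M + 1 then P a 0 \ P a 1 else W a \ P a (M + 1 - b)
  have hEc : ∀ a b, IsClopen (E a b) := fun a b => by
    dsimp only [E]
    split_ifs
    · exact (hW a).diff isClopen_empty
    · exact (hW a).diff (hP _ _)
  have hAc : ∀ a b, IsClopen (A a b) := fun a b => by
    dsimp only [A]
    split_ifs
    · exact hP _ _
    · exact (hP _ _).diff (hP _ _)
    · exact (hW a).diff (hP _ _)
  have hPW' : ∀ a < n, ∀ i, P a i ⊆ W a := fun a ha i => (hPa a (Nat.zero_le i)).trans (hPW a ha)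
  have hAE : ∀ a < n, ∀ b < M + 2, A a b ⊆ E a b := fun a ha b hb => by
    dsimp only [A, E]
    split_ifs with h1 h2
    · simpa using hPW' a ha _
    · rw [h2, show M + 2 - (M + 1) = 1 by omega]
      exact Set.sdiff_subset_sdiff_left (hPW' a ha _)
    · exact Set.sdiff_subset_sdiff_right (hPa a (by omega))
  have hAne : ∀ a < n, ∀ b < M + 2, (A a b).Nonempty := fun a ha b hb => by
    dsimp only [A]
    split_ifs with h1 h2
    · exact hPne _ _
    · exact hPs _ _
    · exact (hPs a 0).mono ((Set.sdiff_subset_sdiff_left (hPW a ha)).trans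
        (Set.sdiff_subset_sdiff_right (hPa a (by omega))))
  have hEW : ∀ a b, E a b ⊆ W a := fun a b => Set.sdiff_subset
  have hlt : ∀ a < n, ∀ b < M + 2, ∀ a' b', a < a' →
      E a' b' ⊆ E a b ∧ (E a' b' ⊆ A a b ∨ Disjoint (E a' b') (A a b)) := by
    intro a ha b hb a' b' haa
    have h1 : E a' b' ⊆ W (a + 1) := (hEW a' b').trans (hWa haa)
    have h2 : ∀ i, Disjoint (E a' b') (P a i) := fun i =>
      ((hdisj a ha).mono_left h1).mono_right (hPa a (Nat.zero_le i))
    have h3 : ∀ i, E a' b' ⊆ W a \ P a i := fun i =>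
      Set.subset_sdiff.2 ⟨h1.trans (hWa (Nat.le_succ a)), h2 i⟩
    constructor
    · refine Set.subset_sdiff.2 ⟨h1.trans (hWa (Nat.le_succ a)), ?_⟩
      split_ifs
      · exact Set.disjoint_empty _
      · exact h2 _
    · dsimp only [A]
      split_ifs
      · exact Or.inr (h2 _)
      · exact Or.inr ((h2 0).mono_right Set.sdiff_subset)
      · exact Or.inl (h3 _)
  have heq : ∀ a < n, ∀ b b', b < b' → b' < M + 2 →
      E a b' ⊆ E a b ∧ (E a b' ⊆ A a b ∨ Disjoint (E a b') (A a b)) := by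
    intro a ha b b' hbb hb'
    have h1 : E a b' = W a \ P a (M + 2 - b') := by
      dsimp only [E]; rw [if_neg (by omega)]
    rw [h1]
    constructor
    · dsimp only [E]
      split_ifs
      · rw [Set.sdiff_empty]; exact Set.sdiff_subset
      · exact Set.sdiff_subset_sdiff_right (hPa a (by omega))
    · dsimp only [A]
      split_ifs with h2 h3
      · exact Or.inr (Set.disjoint_sdiff_left.mono_right (hPa a (by omega)))
      · omega
      · exact Or.inl (Set.sdiff_subset_sdiff_right (hPa a (by omega)))
  have hmod : ∀ i, i % (M + 2) < M + 2 := fun i => Nat.mod_lt _ (by omega)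
  have hdiv : ∀ i < n * (M + 2), i / (M + 2) < n := fun i hi =>
    Nat.div_lt_of_lt_mul (by rwa [mul_comm])
  -- The pairs `(a, b)` with `b < M + 2` are ordered lexicographically and encoded as `(M + 2) * a +
  -- b`.
  obtain ⟨f, hf⟩ := exists_concentrating hd hk μ hμ (fun i => E (i / (M + 2)) (i % (M + 2)))
    (fun i => A (i / (M + 2)) (i % (M + 2))) (n * (M + 2))
    (fun i hi => ⟨hEc _ _, hAc _ _, hAE _ (hdiv i hi) _ (hmod i), hAne _ (hdiv i hi) _ (hmod i)⟩)
    fun j hj i hij => by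
      rcases (Nat.div_le_div_right (c := M + 2) hij.le).lt_or_eq with h | h
      · exact hlt _ (hdiv i (hij.trans hj)) _ (hmod i) _ _ h
      · have h1 := Nat.div_add_mod i (M + 2)
        have h2 := Nat.div_add_mod j (M + 2)
        rw [h] at h1
        simp only [h]
        exact heq _ (hdiv j hj) _ _ (by omega) (hmod j)
  have hf' : ∀ a < n, ∀ b < M + 2, 1 / 2 < (μ (f • E a b)).real (f • A a b) := by
    intro a ha b hb
    have h1 : (M + 2) * a + b < n * (M + 2) := by
      calc (M + 2) * a + b < (M + 2) * a + (M + 2) := by omega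
        _ = (a + 1) * (M + 2) := by ring
        _ ≤ n * (M + 2) := Nat.mul_le_mul_right _ ha
    have := hf _ h1
    rwa [Nat.mul_add_div (by omega), Nat.mul_add_mod, Nat.mod_eq_of_lt hb,
      Nat.div_eq_of_lt hb, add_zero] at this
  refine ⟨f, fun a ha => ⟨?_, fun j hj hj' => ?_, ?_⟩⟩
  · have := hf' a ha 0 (by omega)
    simpa [E, A] using this
  · have := hf' a ha (M + 1 - j) (by omega)
    dsimp only [E, A] at this
    rwa [if_neg (by omega), if_neg (by omega), if_neg (by omega),
      show M + 2 - (M + 1 - j) = j + 1 by omega, show M + 1 - (M + 1 - j) = j by omega] at this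
  · have := hf' a ha (M + 1) (by omega)
    dsimp only [E, A] at this
    rwa [if_neg (by omega), if_neg (by omega), if_pos rfl,
      show M + 2 - (M + 1) = 1 by omega] at this

/-- Two disjoint sets cannot both carry more than half of a probability measure. -/
theorem not_disjoint_of_half_lt {Ω : Type*} [MeasurableSpace Ω] {μ : Measure Ω}
    [IsProbabilityMeasure μ] {S T : Set Ω} (hT : MeasurableSet T)
    (h1 : 1 / 2 < μ.real S) (h2 : 1 / 2 < μ.real T) : ¬ Disjoint S T := fun h => by
  have h3 := measureReal_union (μ := μ) h hT
  have h4 : μ.real (S ∪ T) ≤ 1 := measureReal_le_one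
  linarith

/-- The elements of bounded complexity outside an identity neighbourhood can be avoided by
a conjugate of a given relatively amenable subgroup. -/
theorem exists_conj_avoiding (hd : 2 ≤ d) (hk : 2 ≤ k) {H : Subgroup (Neretin d k)}
    (hH : IsRelativelyAmenable H) {N M : ℕ} {F : Set (Vertex d k)} (hF : ∀ v ∈ F, v.level ≤ N) :
    ∃ f : Neretin d k, ∀ g, IsBounded N M g → g ∉ fixator F → f * g * f⁻¹ ∉ H := by
  borelize (Ends d k)
  obtain ⟨μ, hμ⟩ := exists_invariant_measures hH
  obtain ⟨n, r, e, hr, hinj, he⟩ := exists_enumeration hd hk N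
  -- `W a` is what remains after removing the cylinders of the level `N` vertices with index below
  -- `a`, and `P a i` shrinks to the end `e a` inside the cylinder of index `a`.
  let W : ℕ → Set (Ends d k) := fun a => {ξ | a ≤ r (ξ.ray N)}
  let P : ℕ → ℕ → Set (Ends d k) := fun a i => cyl ((e a).ray (N + i))
  have hW : ∀ a, IsClopen (W a) := fun a => isClopen_ray_preimage N {v | a ≤ r v}
  have hP : ∀ a i, IsClopen (P a i) := fun a i => isClopen_cyl _
  have hPa : ∀ a, Antitone (P a) := fun a i j hij => cyl_ray_anti _ (by omega)
  have hr0 : ∀ a < n, ∀ ξ ∈ P a 0, r (ξ.ray N) = a := fun a ha ξ hξ => by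
    have h : ξ.ray N = (e a).ray N := mem_cyl_ray_iff.1 hξ
    rw [h, he a ha]
  have hr1 : ∀ a < n, ∀ ξ : Ends d k, r (ξ.ray N) = a → ξ ∈ P a 0 := fun a ha ξ hξ =>
    mem_cyl_ray_iff.2 (hinj (level_ray _ _) (level_ray _ _) (hξ.trans (he a ha).symm))
  have hPW : ∀ a < n, P a 0 ⊆ W a := fun a ha ξ hξ => (hr0 a ha ξ hξ).ge
  have hPs : ∀ a i, (P a i \ P a (i + 1)).Nonempty := fun a i => by
    obtain ⟨η, h1, h2⟩ := exists_branch hd hk (e a) (N + i)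
    exact ⟨η, mem_cyl_ray_iff.2 h1, fun h => h2 (mem_cyl_ray_iff.1 h)⟩
  obtain ⟨f, hf⟩ := exists_pattern hd hk μ (fun U hU hne => ⟨(hμ U hU hne).1, (hμ U hU hne).2.1⟩) M
    hW hP (fun a b hab ξ hξ => hab.trans hξ) hPa (fun a i => ⟨e a, mem_cyl_ray _ _⟩) hPs hPW
    fun a ha => Set.disjoint_left.2 fun ξ h h' => by
      have h1 : a + 1 ≤ r (ξ.ray N) := h
      rw [hr0 a ha ξ h'] at h1
      omega
  refine ⟨f, fun g hg hgF hgH => hgF ?_⟩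
  have hinv : ∀ U S, IsClopen U → U.Nonempty → IsClopen S →
      (μ (f • g • U)).real (f • g • S) = (μ (f • U)).real (f • S) := fun U S hU hne hS => by
    have := (hμ (f • U) (ClopenChoice.isClopen_smul f hU) hne.smul_set).2.2 _ hgH (f • S)
      (ClopenChoice.isClopen_smul f hS)
    simpa only [mul_smul, inv_smul_smul] using this
  have hnd : ∀ U S T, IsClopen U → U.Nonempty → IsClopen T →
      1 / 2 < (μ (f • U)).real (f • S) → 1 / 2 < (μ (f • U)).real (f • T) → ¬ Disjoint S T :=
    fun U S T hU hne hT h1 h2 h3 => by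
      have := (hμ (f • U) (ClopenChoice.isClopen_smul f hU) hne.smul_set).1
      exact not_disjoint_of_half_lt (ClopenChoice.isClopen_smul f hT).2.measurableSet h1 h2
        ((Set.disjoint_smul_set).2 h3)
  have hWne : ∀ a < n, ∀ i, (W a \ P a (i + 1)).Nonempty := fun a ha i => (hPs a i).mono
    (Set.sdiff_subset_sdiff_left ((hPa a (Nat.zero_le i)).trans (hPW a ha)))
  -- By strong induction `g` preserves the earlier cylinders, hence also their complement `W a`, so
  -- the measure on `f • W a` can be compared with itself.
  have key : ∀ a < n, g • P a 0 = P a 0 := by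
    intro a
    induction a using Nat.strong_induction_on with
    | _ a ih =>
    intro ha
    obtain ⟨hf0, hfj, hf1⟩ := hf a ha
    have hgW : g • W a = W a := by
      have : W a = (⋃ c ∈ {c | c < a}, P c 0)ᶜ := by
        ext ξ
        simp only [Set.mem_compl_iff, Set.mem_iUnion, not_exists]
        constructor
        · intro h c hc hξ
          have h' : a ≤ r (ξ.ray N) := h
          rw [hr0 c (lt_trans hc ha) ξ hξ] at h'
          exact absurd hc (not_lt.2 h')
        · intro h
          by_contra hlt
          have hlt' : r (ξ.ray N) < a := not_le.1 hlt
          exact h _ hlt' (hr1 _ (hlt'.trans ha) ξ rfl)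
      rw [this, Set.smul_set_compl, Set.smul_set_iUnion₂]
      congr 1
      exact Set.iUnion₂_congr fun c hc => ih c hc (lt_trans hc ha)
    obtain ⟨m, hm1, hm2, hm⟩ := hg (e a)
    have hgP : ∀ i, g • P a i = cyl ((g • e a).ray (m + i)) := hm
    have hWa : (W a).Nonempty := ⟨e a, hPW a ha (mem_cyl_ray _ _)⟩
    -- `P a (M + 1)` and its image both carry more than half of the mass of the same measure, so
    -- they meet. Hence the rays to `e a` and `g • e a` agree up to the smaller of the levels `N + M
    -- + 1` and `m + M + 1`.
    have hray : ∀ j, j ≤ N + (M + 1) → j ≤ m + (M + 1) → (g • e a).ray j = (e a).ray j := by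
      have h1 := hinv (W a) (P a (M + 1)) (hW a) hWa (hP _ _)
      rw [hgW] at h1
      obtain ⟨η, h2, h3⟩ := Set.not_disjoint_iff.1 (hnd (W a) (P a (M + 1)) (g • P a (M + 1)) (hW a)
        hWa (ClopenChoice.isClopen_smul g (hP _ _)) hf0 (h1 ▸ hf0))
      rw [hgP, mem_cyl_ray_iff] at h3
      have h4 := mem_cyl_ray_iff.1 h2
      exact fun j h5 h6 => (ray_eq_of_le h3 h6).symm.trans (ray_eq_of_le h4 h5)
    have hshift : ∀ i j, m + i = N + j → j ≤ M + 1 → i ≤ M + 1 → g • P a i = P a j :=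
      fun i j h1 h2 h3 => by
        rw [hgP, hray _ (by omega) (by omega), h1]
    have hWP : ∀ i, IsClopen (W a \ P a i) := fun i => (hW a).diff (hP a i)
    -- If `m ≠ N`, then `g` acts on the sets `P a i` as a shift by `s + 1 ≤ M` steps. It
    -- interchanges the roles of `W a \ P a 1` and `W a \ P a (s + 2)`, but the first measure is
    -- concentrated on the innermost layer `P a 0 \ P a 1`, while the second is concentrated outside
    -- `P a (s + 1)`. The bound `s + 2 ≤ M + 1` is the reason for the depth `M + 1`.
    rcases lt_trichotomy m N with h | rfl | h
    · exfalso
      obtain ⟨s, rfl⟩ := Nat.exists_eq_add_of_lt h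
      have h0 := hshift (s + 1) 0 (by omega) (by omega) (by omega)
      have h1 := hshift (s + 2) 1 (by omega) (by omega) (by omega)
      have h2 := hinv (W a \ P a (s + 2)) (W a \ P a (s + 1)) (hWP _) (hWne a ha _) (hWP _)
      rw [show g • (W a \ P a (s + 2)) = W a \ P a 1 by rw [Set.smul_set_sdiff, hgW, h1],
        show g • (W a \ P a (s + 1)) = W a \ P a 0 by rw [Set.smul_set_sdiff, hgW, h0]] at h2
      have h3 := hfj (s + 1) (by omega) (by omega)
      rw [← h2] at h3
      exact hnd _ _ _ (hWP 1) (hWne a ha 0) ((hP a 0).diff (hP a 1)) h3 hf1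
        (Set.disjoint_sdiff_left.mono_right Set.sdiff_subset)
    · exact hshift 0 0 rfl (by omega) (by omega)
    · exfalso
      obtain ⟨s, rfl⟩ := Nat.exists_eq_add_of_lt h
      have h0 := hshift 0 (s + 1) (by omega) (by omega) (by omega)
      have h1 := hshift 1 (s + 2) (by omega) (by omega) (by omega)
      have h2 := hinv (W a \ P a 1) (P a 0 \ P a 1) (hWP _) (hWne a ha _) ((hP _ _).diff (hP _ _))
      rw [show g • (W a \ P a 1) = W a \ P a (s + 2) by rw [Set.smul_set_sdiff, hgW, h1],
        show g • (P a 0 \ P a 1) = P a (s + 1) \ P a (s + 2) by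
          rw [Set.smul_set_sdiff, h0, h1]] at h2
      rw [← h2] at hf1
      exact hnd _ _ _ (hWP (s + 2)) (hWne a ha _) ((hP a _).diff (hP a _))
        (hfj (s + 1) (by omega) (by omega)) hf1
        (Set.disjoint_sdiff_left.mono_right Set.sdiff_subset)
  have hcyl : ∀ ξ : Ends d k, g • cyl (ξ.ray N) = cyl (ξ.ray N) := fun ξ => by
    have h1 := hr _ (level_ray ξ N)
    have h2 : ξ.ray N = (e (r (ξ.ray N))).ray N := mem_cyl_ray_iff.1 (hr1 _ h1 ξ rfl)
    rw [h2]
    exact key _ h1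
  have hN : ∀ ξ : Ends d k, (g • ξ).ray N = ξ.ray N := fun ξ =>
    mem_cyl_ray_iff.1 (hcyl ξ ▸ Set.smul_mem_smul_set (mem_cyl_ray ξ N))
  -- As `g` fixes each cylinder of level `N` and cylinders determine levels, the shift along every
  -- ray vanishes.
  refine mem_fixator_of_smul_cyl (N := N) (fun ξ i => ?_) hN (nonempty_cyl hd hk) hF
  obtain ⟨m, -, -, hm⟩ := hg ξ
  have h1 := hm 0
  rw [add_zero, add_zero, hcyl ξ] at h1
  obtain rfl : m = N :=
    (le_of_cyl_ray_subset hd hk h1.subset).antisymm (le_of_cyl_ray_subset hd hk h1.symm.subset)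
  exact hm i

end Neretin

/-! ### Chabauty neighbourhoods of the trivial subgroup -/

/-- An identity neighbourhood in the Chabauty space contains all closed subgroups that avoid
some compact set without the identity. -/
theorem exists_compact_of_isOpen_chabauty {G : Type u} [Group G] [TopologicalSpace G]
    {s : Set (ClosedSubgroup G)} (hs : IsOpen s) {B : ClosedSubgroup G}
    (hB : (B : Subgroup G) = ⊥) (hBs : B ∈ s) :
    ∃ K : Set G, IsCompact K ∧ 1 ∉ K ∧ ∀ L : ClosedSubgroup G, (L : Set G) ∩ K = ∅ → L ∈ s := by
  have hmem : ∀ x : G, x ∈ (B : Set G) ↔ x = 1 := fun x => by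
    change x ∈ (B : Subgroup G) ↔ _
    rw [hB, Subgroup.mem_bot]
  induction hs with
  | basic s hs =>
    rcases hs with ⟨K, hK, rfl⟩ | ⟨U, -, rfl⟩
    · refine ⟨K, hK, fun h => ?_, fun L hL => hL⟩
      have h1 : (B : Set G) ∩ K = ∅ := hBs
      exact Set.eq_empty_iff_forall_notMem.1 h1 1 ⟨(hmem 1).2 rfl, h⟩
    -- An open set met by the trivial subgroup contains the identity, so every subgroup meets it and
    -- no compact set is needed.
    · obtain ⟨x, hx, hxU⟩ : ((B : Set G) ∩ U).Nonempty := hBs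
      rw [hmem] at hx
      subst hx
      exact ⟨∅, isCompact_empty, Set.notMem_empty 1,
        fun L _ => ⟨1, one_mem (L : Subgroup G), hxU⟩⟩
  | univ => exact ⟨∅, isCompact_empty, Set.notMem_empty 1, fun _ _ => trivial⟩
  | inter s t _ _ ihs iht =>
    obtain ⟨K, hK, h1, h2⟩ := ihs hBs.1
    obtain ⟨K', hK', h1', h2'⟩ := iht hBs.2
    refine ⟨K ∪ K', hK.union hK', fun h => h.elim h1 h1', fun L hL => ?_⟩
    rw [Set.inter_union_distrib_left, Set.union_empty_iff] at hL
    exact ⟨h2 L hL.1, h2' L hL.2⟩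
  | sUnion S _ ih =>
    obtain ⟨t, ht, hBt⟩ := hBs
    obtain ⟨K, hK, h1, h2⟩ := ih t ht hBt
    exact ⟨K, hK, h1, fun L hL => ⟨t, ht, h2 L hL⟩⟩

/-- If every compact set without the identity is avoided by some conjugate of `H`, then `H` is not
confined. -/
theorem not_isConfined_of_avoids {G : Type u} [Group G] [TopologicalSpace G]
    [IsTopologicalGroup G] [T1Space G] {H : ClosedSubgroup G}
    (h : ∀ K : Set G, IsCompact K → 1 ∉ K → ∃ f : G, ∀ g ∈ K, f * g * f⁻¹ ∉ (H : Subgroup G)) :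
    ¬ IsConfined H := by
  intro hc
  let B : ClosedSubgroup G := ⟨⊥, isClosed_singleton (x := (1 : G))⟩
  refine hc B (mem_closure_iff.2 fun s hs hBs => ?_) rfl
  obtain ⟨K, hK, h1, hK'⟩ := exists_compact_of_isOpen_chabauty hs (B := B) rfl hBs
  obtain ⟨f, hf⟩ := h K hK h1
  have hmem : ∀ g, g ∈ (H : Subgroup G).map (MulAut.conj f⁻¹).toMonoidHom ↔
      f * g * f⁻¹ ∈ (H : Subgroup G) := fun g => by
    constructor
    · rintro ⟨x, hx, rfl⟩
      simpa [mul_assoc] using hx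
    · exact fun hg => ⟨_, hg, by simp [mul_assoc]⟩
  refine ⟨⟨(H : Subgroup G).map (MulAut.conj f⁻¹).toMonoidHom, ?_⟩, hK' _ ?_, f⁻¹, rfl⟩
  · have : IsClosed ((fun g => f * g * f⁻¹) ⁻¹' (H : Set G)) :=
      H.isClosed'.preimage (by fun_prop)
    convert this using 1
    exact Set.ext hmem
  · refine Set.eq_empty_of_forall_notMem fun g hg => hf g hg.2 ((hmem g).1 hg.1)

/-- An amenable subgroup is relatively amenable. -/
theorem IsAmenable.isRelativelyAmenable {G : Type u} [Group G] [TopologicalSpace G]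
    {H : Subgroup G} (h : IsAmenable H) : IsRelativelyAmenable H := by
  intro X _ _ _ _ _ _ _ _
  obtain ⟨μ, h1, h2, h3⟩ := h X
  exact ⟨μ, h1, h2, fun g hg => h3 ⟨g, hg⟩ trivial⟩

/-! ### Uniform bounds on compact sets, and cocompact subgroups -/

namespace Neretin

variable {d k : ℕ}

open Ends

theorem exists_isBounded_finset (T : Finset (Neretin d k)) :
    ∃ N M, ∀ g ∈ T, IsBounded N M g := by
  classical
  induction T using Finset.induction_on with
  | empty => exact ⟨0, 0, by simp⟩
  | insert g T _ ih =>
    obtain ⟨N, M, h⟩ := ih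
    obtain ⟨N', M', h'⟩ := exists_isBounded g
    refine ⟨max N N', max M M', fun a ha => ?_⟩
    obtain rfl | ha := Finset.mem_insert.1 ha
    · exact h'.mono (le_max_right _ _) (le_max_right _ _)
    · exact (h a ha).mono (le_max_left _ _) (le_max_left _ _)

theorem exists_level_bound {F : Set (Vertex d k)} (hF : F.Finite) : ∃ N, ∀ v ∈ F, v.level ≤ N := by
  obtain ⟨N, hN⟩ := (hF.image Vertex.level).bddAbove
  exact ⟨N, fun v hv => hN ⟨v, hv, rfl⟩⟩

/-- `fixator ∅` is the image of the whole automorphism group of the rooted tree, whose elements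
shift no levels. Multiplying by them on the right preserves boundedness uniformly. -/
theorem exists_isBounded_of_cosets (T : Finset (Neretin d k)) :
    ∃ N M, ∀ g, (∃ c ∈ T, c⁻¹ * g ∈ fixator ∅) → IsBounded N M g := by
  obtain ⟨N, M, h⟩ := exists_isBounded_finset T
  refine ⟨N + 0 + 0, M + 0, fun g ⟨c, hc, hg⟩ => ?_⟩
  have := (h c hc).mul (isBounded_of_mem_fixator hg)
  rwa [mul_inv_cancel_left] at this

/-- Compact sets are uniformly bounded, and separated from the identity unless they contain it. -/
theorem exists_bound_of_isCompact {K : Set (Neretin d k)} (hK : IsCompact K) (h1 : 1 ∉ K) :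
    ∃ (N M : ℕ) (F : Set (Vertex d k)), (∀ v ∈ F, v.level ≤ N) ∧
      ∀ g ∈ K, IsBounded N M g ∧ g ∉ fixator F := by
  obtain ⟨F, hF, hFK⟩ := exists_fixator_subset (hK.isClosed.isOpen_compl.mem_nhds h1)
  obtain ⟨T, -, hT⟩ := hK.elim_nhds_subcover (fun c => {g | c⁻¹ * g ∈ fixator ∅})
    fun c _ => coset_mem_nhds Set.finite_empty c
  obtain ⟨N, M, hNM⟩ := exists_isBounded_of_cosets T
  obtain ⟨N', hN'⟩ := exists_level_bound hF
  refine ⟨max N N', M, F, fun v hv => (hN' v hv).trans (le_max_right _ _), fun g hg => ⟨?_, ?_⟩⟩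
  · refine (hNM g ?_).mono (le_max_left _ _) le_rfl
    obtain ⟨c, hc, hgc⟩ := Set.mem_iUnion₂.1 (hT hg)
    exact ⟨c, hc, hgc⟩
  · exact fun h => hFK h hg

/-- The ball of radius `n` is invariant under tree automorphisms, so its fixator is normalized by
them. -/
theorem conj_mem_fixator {n : ℕ} (hne : ∀ v : Vertex d k, (cyl v).Nonempty) {o a : Neretin d k}
    (ho : o ∈ fixator ∅)
    (ha : a ∈ fixator {v : Vertex d k | v.level ≤ n}) :
    o⁻¹ * a * o ∈ fixator {v : Vertex d k | v.level ≤ n} := by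
  have key : ∀ {g : Neretin d k}, IsBounded 0 0 g → ∀ (ξ : Ends d k) i,
      g • cyl (ξ.ray i) = cyl ((g • ξ).ray i) := fun hg ξ i => by
    obtain ⟨m, h1, -, h2⟩ := hg ξ
    obtain rfl : m = 0 := by omega
    simpa using h2 i
  have ho' := isBounded_of_mem_fixator (inv_mem ho)
  refine mem_fixator_of_smul_cyl (N := n) (fun ξ i => key ?_ ξ _) (fun ξ => ?_) hne fun v hv => hv
  · exact (ho'.mul (isBounded_of_mem_fixator ha)).mul (isBounded_of_mem_fixator ho)
  · rw [← mem_cyl_ray_iff, mul_smul, mul_smul]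
    have h1 := key ho' (o • ξ) n
    rw [inv_smul_smul] at h1
    rw [← h1, Set.smul_mem_smul_set_iff, smul_mem_cyl_iff ha (level_ray _ _).le]
    exact mem_cyl_ray _ _

/-- A cylinder of level `N + 1` can be squeezed into a disjoint one of level `N + M + 2`, which
takes a shift exceeding `M`. This rules out that the trivial subgroup is cocompact. -/
theorem not_forall_isBounded (hd : 2 ≤ d) (hk : 2 ≤ k) (N M : ℕ) :
    ¬ ∀ g : Neretin d k, IsBounded N M g := by
  intro h
  obtain ⟨ξ, -⟩ := nonempty_cyl hd hk (Vertex.root : Vertex d k)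
  obtain ⟨η, h1, h2⟩ := exists_branch hd hk ξ N
  obtain ⟨s, -, hs⟩ := exists_compress hd hk (isClopen_cyl (ξ.ray (N + 1)))
    (z := η.ray (N + M + 2)) (Set.disjoint_left.2 fun ζ h3 h4 => h2 <| by
      rw [← mem_cyl_ray_iff.1 h3]
      exact ray_eq_of_le (mem_cyl_ray_iff.1 h4).symm (by omega))
  obtain ⟨m, h3, -, h4⟩ := h s ξ
  rw [h4 1] at hs
  have := le_of_cyl_ray_subset hd hk hs
  omega

/-- The images of the cosets of the open subgroup `fixator ∅` are open in the compact quotient, so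
finitely many of them cover it. -/
theorem exists_cosets_of_isCocompact {H : Subgroup (Neretin d k)} (hH : IsCocompact H) :
    ∃ T : Finset (Neretin d k), ∀ g, ∃ c ∈ T, ∃ o ∈ fixator ∅, ∃ h ∈ H, g = c * o * h := by
  classical
  have hH' : CompactSpace (Neretin d k ⧸ H) := hH
  obtain ⟨t, ht⟩ := hH'.elim_nhds_subcover
    (fun x => ((↑) : Neretin d k → Neretin d k ⧸ H) '' {g | x.out⁻¹ * g ∈ fixator ∅}) fun x => by
      have := (QuotientGroup.isOpenMap_coe (N := H)).image_mem_nhds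
        (coset_mem_nhds Set.finite_empty (Quotient.out x : Neretin d k))
      rwa [QuotientGroup.out_eq'] at this
  refine ⟨t.image Quotient.out, fun g => ?_⟩
  obtain ⟨x, hx, g', hg', hgg⟩ := Set.mem_iUnion₂.1
    (ht.symm.subset (Set.mem_univ (g : Neretin d k ⧸ H)))
  exact ⟨_, Finset.mem_image_of_mem _ hx, _, hg', _, QuotientGroup.eq.1 hgg, by group⟩

/-- A relatively amenable subgroup is not cocompact. -/
theorem not_isCocompact (hd : 2 ≤ d) (hk : 2 ≤ k) {H : Subgroup (Neretin d k)}
    (hH : IsRelativelyAmenable H) : ¬ IsCocompact H := by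
  classical
  intro hc
  obtain ⟨T, hT⟩ := exists_cosets_of_isCocompact hc
  obtain ⟨N, M, hNM⟩ := exists_isBounded_of_cosets T
  obtain rfl | ⟨h₀, hh, hne⟩ := H.bot_or_exists_ne_one
  · refine not_forall_isBounded hd hk N M fun g => hNM g ?_
    obtain ⟨c, hc, o, ho, h, hh, rfl⟩ := hT g
    rw [Subgroup.mem_bot.1 hh]
    exact ⟨c, hc, by simpa using ho⟩
  obtain ⟨F₀, hF₀, hhF₀⟩ := exists_notMem_fixator hne
  obtain ⟨n, hn⟩ := exists_level_bound hF₀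
  have hB : {v : Vertex d k | v.level ≤ n}.Finite :=
    ((Set.finite_le_nat n).biUnion fun i _ => Vertex.finite_level_eq i).subset
      fun v hv => Set.mem_iUnion₂.2 ⟨v.level, hv, rfl⟩
  -- If a conjugate of `h₀` by `c * o` fixed all of `Fc c`, then undoing `c`, and then `o`, would
  -- put `h₀` into the fixator of the ball. Finitely many `c` occur, so one finite set serves for
  -- all conjugates.
  choose Fc hFc hFc' using fun c : Neretin d k => exists_fixator_conj c⁻¹ hB
  have hF : (⋃ c ∈ T, Fc c).Finite := T.finite_toSet.biUnion fun c _ => hFc c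
  obtain ⟨N₁, hN₁⟩ := exists_level_bound hF
  obtain ⟨N₂, M₂, h₂⟩ := exists_isBounded h₀
  obtain ⟨N₃, M₃, h₃⟩ := exists_isBounded_finset (T.image fun c => c⁻¹)
  have hbd : ∀ c ∈ T, ∀ o ∈ fixator (∅ : Set (Vertex d k)),
      IsBounded (N + N₂ + M₂ + (0 + N₃ + M₃) + (0 + M₃)) (M + M₂ + (0 + M₃))
        (c * o * h₀ * (c * o)⁻¹) := fun c hc o ho => by
    rw [mul_inv_rev]
    exact ((hNM _ ⟨c, hc, by simpa using ho⟩).mul h₂).mul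
      ((isBounded_of_mem_fixator (inv_mem ho)).mul (h₃ _ (Finset.mem_image_of_mem _ hc)))
  -- The bounds are uniform in `c` and `o`, so `f` can be fixed before the decomposition of `f⁻¹`
  -- singles out the conjugate of `h₀` that gives the contradiction.
  obtain ⟨f, hf⟩ := exists_conj_avoiding hd hk hH
    (N := max (N + N₂ + M₂ + (0 + N₃ + M₃) + (0 + M₃)) N₁) (M := M + M₂ + (0 + M₃))
    fun v hv => (hN₁ v hv).trans (le_max_right _ _)
  obtain ⟨c, hc, o, ho, h, hh', hfe⟩ := hT f⁻¹
  refine hf _ ((hbd c hc o ho).mono (le_max_left _ _) le_rfl) (fun hmem => hhF₀ ?_) ?_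
  · have h1 := hFc' c _ (fixator_anti (Set.subset_iUnion₂ c hc) hmem)
    have h2 := conj_mem_fixator (nonempty_cyl hd hk) ho h1
    rw [show o⁻¹ * (c⁻¹ * (c * o * h₀ * (c * o)⁻¹) * c⁻¹⁻¹) * o = h₀ by group] at h2
    exact fixator_anti hn h2
  · rw [inv_eq_iff_eq_inv] at hfe
    rw [hfe]
    have : (c * o * h)⁻¹ * (c * o * h₀ * (c * o)⁻¹) * (c * o * h)⁻¹⁻¹ = h⁻¹ * h₀ * h := by group
    rw [this]
    exact mul_mem (mul_mem (inv_mem hh') hh) hh'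

end Neretin

theorem corollary1p3 (d k : ℕ) (hd : 2 ≤ d) (hk : 2 ≤ k) :
    (∀ H : ClosedSubgroup (Neretin d k),
      ¬ (IsRelativelyAmenable (H : Subgroup (Neretin d k)) ∧ IsConfined H)) ∧
    (∀ H : Subgroup (Neretin d k), ¬ (IsCocompact H ∧ IsAmenable H)) := by
  refine ⟨fun H ⟨hH, hc⟩ => not_isConfined_of_avoids (fun K hK h1 => ?_) hc, fun H ⟨hc, hH⟩ =>
    Neretin.not_isCocompact hd hk hH.isRelativelyAmenable hc⟩
  obtain ⟨N, M, F, hF, hb⟩ := Neretin.exists_bound_of_isCompact hK h1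
  obtain ⟨f, hf⟩ := Neretin.exists_conj_avoiding hd hk hH (N := N) (M := M) hF
  exact ⟨f, fun g hg => hf g (hb g hg).1 (hb g hg).2⟩
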